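/- Let $1<m<2$, $p=2-m\in(0,1)$, $\sigma>2$, and set $$\alpha=\frac{\sigma+2}{(\sigma-2)(m-1)},\qquad \beta=\frac{2}{\sigma-2}.$$ A profile is a continuous function $f:[0,\infty)\to[0,\infty)$ that is a classical solution on $(0,\infty)$ (that is, $f$ is differentiable and $f^m$ is twice differentiable there) of $$(f^m)''(\xi)-\alpha f(\xi)+\beta\xi f'(\xi)+\xi^{\sigma}f^{2-m}(\xi)=0 .$$ Consider, in the phase space $\{X\ge 0,\ Z\ge 0\}$, the autonomous system $$\dot X=X[(m-1)Y-2X],\qquad \dot Y=-Y^2-\frac{\beta}{\alpha}Y+X-XY-Z,\qquad \dot Z=(\sigma-2)XZ ,$$ and its critical points $P_0^{\lambda}=\left(0,\lambda,-\lambda^2-\frac{\beta}{\alpha}\lambda\right)$. An orbit is a solution $(X,Y,Z)(\eta)$ on its maximal interval of existence $I$; it enters $P_0^\lambda$ if it is not the constant orbit $P_0^\lambda$, $I$ is unbounded above, and $(X,Y,Z)(\eta)\to P_0^\lambda$ as $\eta\to+\infty$. The orbit contains the profile $f$ if there is a change of variable $\eta=\eta(\xi)$ from $\{\xi>0: f(\xi)>0\}$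 onto $I$ with $\frac{d\eta}{d\xi}=\frac{\alpha}{m}\xi f^{1-m}(\xi)$ and $$X(\eta(\xi))=\frac{m}{\alpha}\xi^{-2}f^{m-1}(\xi),\quad Y(\eta(\xi))=\frac{m}{\alpha}\xi^{-1}f^{m-2}(\xi)f'(\xi),\quad Z(\eta(\xi))=\frac{m}{\alpha^2}\xi^{\sigma-2}.$$ Proposition. Let $\lambda\in\left(-\frac{\beta}{\alpha},-\frac{\beta}{2\alpha}\right)$. Every orbit entering $P_0^\lambda$ contains a profile, and every profile $f$ contained in such an orbit is non-increasing on $[0,\infty)$ and satisfies $f(0)>0$ and $f'(0)<0$ (one-sided derivative). Moreover, for every such $f$ and every $T>0$, the self-similar function $$u(x,t)=(T-t)^{-\alpha}f\left(|x|(T-t)^{\beta}\right),\qquad x\in\mathbb{R},\ t\in(0,T),$$ is a weak supersolution of $u_t=(u^m)_{xx}+|x|^{\sigma}u^p$ in $\mathbb{R}\times(0,T)$: $u$ is continuous and nonnegative, and for every nonnegative $\varphi\in C_c^\infty(\mathbb{R}\times(0,T))$, $$\int_0^T\!\!\int_{\mathbb{R}}\left(u\,\varphi_t+u^m\varphi_{xx}+|x|^{\sigma}u^p\varphi\right)dx\,dt\le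 0 .$$ -/

import Mathlib

open Set Filter Topology
open scoped ContDiff

namespace SelfSimilar

noncomputable section

/-- The self-similarity exponent `α` (for `m + p = 2`). -/
def ssAlpha (m σ : ℝ) : ℝ := (σ + 2) / ((σ - 2) * (m - 1))

/-- The self-similarity exponent `β` (for `m + p = 2`). -/
def ssBeta (σ : ℝ) : ℝ := 2 / (σ - 2)

/-- `f` is a (nonnegative) profile: a continuous function on `[0,∞)` which is a classical solution
on `(0,∞)` of `(f^m)'' - α f + β ξ f' + ξ^σ f^(2-m) = 0`.
The values of `f` on the negative axis are irrelevant. -/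
structure IsProfile (m σ : ℝ) (f : ℝ → ℝ) : Prop where
  continuousOn : ContinuousOn f (Ici 0)
  nonneg : ∀ ξ, 0 ≤ ξ → 0 ≤ f ξ
  differentiableAt : ∀ ξ, 0 < ξ → DifferentiableAt ℝ f ξ
  differentiableAt_deriv : ∀ ξ, 0 < ξ → DifferentiableAt ℝ (deriv fun s => f s ^ m) ξ
  ode : ∀ ξ, 0 < ξ →
    deriv (deriv fun s => f s ^ m) ξ - ssAlpha m σ * f ξ + ssBeta σ * ξ * deriv f ξ
      + ξ ^ σ * f ξ ^ (2 - m) = 0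

/-- `(X, Y, Z)` is a solution, on the nonempty open interval `I`, of the autonomous system. -/
structure IsTrajectory (m σ : ℝ) (X Y Z : ℝ → ℝ) (I : Set ℝ) : Prop where
  isOpen : IsOpen I
  ordConnected : I.OrdConnected
  nonempty : I.Nonempty
  hasDerivAt_X : ∀ η ∈ I, HasDerivAt X (X η * ((m - 1) * Y η - 2 * X η)) η
  hasDerivAt_Y : ∀ η ∈ I, HasDerivAt Y
    (-(Y η) ^ 2 - ssBeta σ / ssAlpha m σ * Y η + X η - X η * Y η - Z η) η
  hasDerivAt_Z : ∀ η ∈ I, HasDerivAt Z ((σ - 2) * X η * Z η) η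

/-- A trajectory in the phase space `{X ≥ 0, Z ≥ 0}` on its maximal interval of existence `I`
(a complete orbit, with a parametrization). -/
structure IsOrbit (m σ : ℝ) (X Y Z : ℝ → ℝ) (I : Set ℝ) : Prop where
  isTrajectory : IsTrajectory m σ X Y Z I
  nonneg_X : ∀ η ∈ I, 0 ≤ X η
  nonneg_Z : ∀ η ∈ I, 0 ≤ Z η
  maximal : ∀ (X' Y' Z' : ℝ → ℝ) (J : Set ℝ), IsTrajectory m σ X' Y' Z' J → I ⊆ J →
    EqOn X X' I → EqOn Y Y' I → EqOn Z Z' I → J ⊆ I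

/-- The point `P₀^λ` of the critical parabola. -/
def critPoint (m σ l : ℝ) : ℝ × ℝ × ℝ := (0, l, -l ^ 2 - ssBeta σ / ssAlpha m σ * l)

/-- The orbit enters the point `P` (as `η → +∞`), and is not reduced to the point `P`. -/
structure Enters (X Y Z : ℝ → ℝ) (I : Set ℝ) (P : ℝ × ℝ × ℝ) : Prop where
  mem_atTop : ∃ c, Ici c ⊆ I
  tendsto : Tendsto (fun η => (X η, Y η, Z η)) atTop (𝓝 P)
  nontrivial : ∃ η ∈ I, (X η, Y η, Z η) ≠ P

/-- The function `f` is contained in the orbit `(X, Y, Z)`: there is an independent variable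
`η = η(ξ)` with `dη/dξ = (α/m) ξ f^(1-m)` which maps the positivity set of `f` onto the whole
parameter interval `I` of the orbit, and `X, Y, Z` are obtained from `f` through
`X = (m/α) ξ^(-2) f^(m-1)`, `Y = (m/α) ξ^(-1) f^(m-2) f'`, `Z = (m/α^2) ξ^(σ-2)`. -/
def OrbitContains (m σ : ℝ) (X Y Z : ℝ → ℝ) (I : Set ℝ) (f : ℝ → ℝ) : Prop :=
  ∃ η : ℝ → ℝ, η '' {ξ | 0 < ξ ∧ 0 < f ξ} = I ∧
    ∀ ξ, 0 < ξ → 0 < f ξ →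
      HasDerivAt η (ssAlpha m σ / m * ξ * f ξ ^ (1 - m)) ξ ∧
      X (η ξ) = m / ssAlpha m σ * (ξ ^ 2)⁻¹ * f ξ ^ (m - 1) ∧
      Y (η ξ) = m / ssAlpha m σ * ξ⁻¹ * f ξ ^ (m - 2) * deriv f ξ ∧
      Z (η ξ) = m / ssAlpha m σ ^ 2 * ξ ^ (σ - 2)

/-- The self-similar function `u(x,t) = (T-t)^(-α) f(|x| (T-t)^β)`. -/
def selfSimilar (m σ T : ℝ) (f : ℝ → ℝ) (x t : ℝ) : ℝ :=
  (T - t) ^ (-ssAlpha m σ) * f (|x| * (T - t) ^ ssBeta σ)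

/-- `u` is a (continuous, nonnegative) weak supersolution of `u_t = (u^m)_xx + |x|^σ u^p` in
`ℝ × (0,T)`: for every nonnegative test function `φ ∈ C_c^∞(ℝ × (0,T))`,
`∬ (u φ_t + u^m φ_xx + |x|^σ u^p φ) dx dt ≤ 0`. -/
structure IsSupersolution (m p σ T : ℝ) (u : ℝ → ℝ → ℝ) : Prop where
  continuousOn : ContinuousOn (fun z : ℝ × ℝ => u z.1 z.2) (univ ×ˢ Ioo 0 T)
  nonneg : ∀ x, ∀ t ∈ Ioo 0 T, 0 ≤ u x t
  weak : ∀ φ : ℝ × ℝ → ℝ, ContDiff ℝ ∞ φ → HasCompactSupport φ →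
    tsupport φ ⊆ univ ×ˢ Ioo 0 T → (∀ z, 0 ≤ φ z) →
    ∫ z : ℝ × ℝ, (u z.1 z.2 * deriv (fun t => φ (z.1, t)) z.2
      + u z.1 z.2 ^ m * iteratedDeriv 2 (fun x => φ (x, z.2)) z.1
      + |z.1| ^ σ * u z.1 z.2 ^ p * φ z) ≤ 0

end

end SelfSimilar

namespace SelfSimilar

/-! Write b = β/α. Along the orbit X and Z are positive: a trajectory touching {X = 0} stays there,
where Z is frozen and Y = λ is repelling because 2λ < -b; and {Z = 0} is invariant while the limit
of Z is positive. Hence Z increases to -λ² - bλ, which makes Y = -b/2 a one-way barrier: once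
reached, Y could not return to λ. So Y < 0 throughout. Now Z determines a radius r and X an
amplitude φ, with r' = rX and φ' = φY; the radius increases to a finite ξ₀ and the amplitude
decreases to 0.

The crux is that, followed backwards, the orbit reaches radius 0 with bounded amplitude. The
quantity (f^m)' - αξf + (α+β)ξ₀f has derivative (α+β)(ξ₀-ξ)f' - ξ^σ f^(2-m) < 0 and tends to 0 at
ξ₀, so it is positive (`flux_pos`). This bounds the slope of the pressure f^(m-1) from below, hence
f from above (`φ_rpow_le`), and by monotonicity φ, r and rY converge at the left end. If r had a
positive limit, X, Y and Z would converge too and the orbit could be continued, against maximality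
(`tendsto_r_zero`).

Thus f lives on (0, ξ₀) with f(0) > 0, and (f^m)' has a limit at 0. That limit is nonpositive, and
it is not 0, since otherwise (f^m)'' would tend to αf(0) > 0. At ξ₀ the finite limit of Y makes the
extension by zero a classical solution. Finally, u solves the equation classically for x ≠ 0, and
its even reflection has a concave corner at x = 0: two integrations by parts leave a boundary term
with the sign of (f^m)'(0) (`integral_abs_by_parts`). -/

theorem antitoneOn_of_hasDerivAt_nonpos {S : Set ℝ} (hS : S.OrdConnected) {f f' : ℝ → ℝ}
    (hf : ∀ x ∈ S, HasDerivAt f (f' x) x) (hf' : ∀ x ∈ S, f' x ≤ 0) : AntitoneOn f S :=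
  antitoneOn_of_hasDerivWithinAt_nonpos hS.convex
    (fun x hx => (hf x hx).continuousAt.continuousWithinAt)
    (fun x hx => (hf x (interior_subset hx)).hasDerivWithinAt)
    (fun x hx => hf' x (interior_subset hx))

theorem monotoneOn_of_hasDerivAt_nonneg {S : Set ℝ} (hS : S.OrdConnected) {f f' : ℝ → ℝ}
    (hf : ∀ x ∈ S, HasDerivAt f (f' x) x) (hf' : ∀ x ∈ S, 0 ≤ f' x) : MonotoneOn f S :=
  monotoneOn_of_hasDerivWithinAt_nonneg hS.convex
    (fun x hx => (hf x hx).continuousAt.continuousWithinAt)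
    (fun x hx => (hf x (interior_subset hx)).hasDerivWithinAt)
    (fun x hx => hf' x (interior_subset hx))

theorem strictMonoOn_of_hasDerivAt_pos {S : Set ℝ} (hS : S.OrdConnected) {f f' : ℝ → ℝ}
    (hf : ∀ x ∈ S, HasDerivAt f (f' x) x) (hf' : ∀ x ∈ S, 0 < f' x) : StrictMonoOn f S :=
  strictMonoOn_of_hasDerivWithinAt_pos hS.convex
    (fun x hx => (hf x hx).continuousAt.continuousWithinAt)
    (fun x hx => (hf x (interior_subset hx)).hasDerivWithinAt)
    (fun x hx => hf' x (interior_subset hx))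

theorem strictAntiOn_of_hasDerivAt_neg {S : Set ℝ} (hS : S.OrdConnected) {f f' : ℝ → ℝ}
    (hf : ∀ x ∈ S, HasDerivAt f (f' x) x) (hf' : ∀ x ∈ S, f' x < 0) : StrictAntiOn f S :=
  strictAntiOn_of_hasDerivWithinAt_neg hS.convex
    (fun x hx => (hf x hx).continuousAt.continuousWithinAt)
    (fun x hx => (hf x (interior_subset hx)).hasDerivWithinAt)
    (fun x hx => hf' x (interior_subset hx))

/-- A solution of a scalar linear equation on an interval that vanishes once vanishes identically. -/
theorem eq_zero_of_hasDerivAt_mul {I : Set ℝ} (hI : I.OrdConnected) {y a : ℝ → ℝ}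
    (hy : ∀ η ∈ I, HasDerivAt y (a η * y η) η) (ha : ContinuousOn a I) {s t : ℝ} (hs : s ∈ I)
    (ht : t ∈ I) (h0 : y s = 0) : y t = 0 := by
  have hsub : uIcc s t ⊆ I := hI.uIcc_subset hs ht
  obtain ⟨K, hK⟩ := isCompact_uIcc.exists_bound_of_continuousOn (ha.mono hsub)
  -- Gronwall by an exponential weight: if |a| ≤ K on the segment, y² e^(-2Kη) is nonincreasing and
  -- y² e^(2Kη) nondecreasing, so a zero propagates forwards and backwards respectively.
  have hd : ∀ (k : ℝ), ∀ η ∈ uIcc s t, HasDerivAt (fun η => y η ^ 2 * Real.exp (k * η))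
      ((2 * a η + k) * (y η ^ 2 * Real.exp (k * η))) η := by
    intro k η hη
    have h1 := (hy η (hsub hη)).pow 2
    have h2 : HasDerivAt (fun η => Real.exp (k * η)) (Real.exp (k * η) * (k * 1)) η :=
      ((hasDerivAt_id η).const_mul k).exp
    refine (h1.mul h2).congr_deriv ?_
    simp only [Pi.pow_apply, Nat.cast_ofNat]
    ring
  have hord : (uIcc s t).OrdConnected := ordConnected_uIcc
  rcases le_total s t with hst | hst
  · have hanti := antitoneOn_of_hasDerivAt_nonpos hord (hd (-(2 * K))) (fun η hη => by
      have := (abs_le.mp (hK η hη)).2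
      exact mul_nonpos_of_nonpos_of_nonneg (by linarith) (by positivity))
    have h := hanti left_mem_uIcc right_mem_uIcc hst
    simp only [h0] at h
    have h3 := Real.exp_pos (-(2 * K) * t)
    have h4 : y t ^ 2 ≤ 0 := by
      by_contra hc
      push Not at hc
      nlinarith [mul_pos hc h3]
    exact pow_eq_zero_iff (two_ne_zero) |>.mp (le_antisymm h4 (sq_nonneg _))
  · have hmono := monotoneOn_of_hasDerivAt_nonneg hord (hd (2 * K)) (fun η hη => by
      have := (abs_le.mp (hK η hη)).1
      exact mul_nonneg (by linarith) (by positivity))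
    have h := hmono right_mem_uIcc left_mem_uIcc hst
    simp only [h0] at h
    have h3 := Real.exp_pos (2 * K * t)
    have h4 : y t ^ 2 ≤ 0 := by
      by_contra hc
      push Not at hc
      nlinarith [mul_pos hc h3]
    exact pow_eq_zero_iff (two_ne_zero) |>.mp (le_antisymm h4 (sq_nonneg _))

theorem ssAlpha_pos {m σ : ℝ} (hm : 1 < m) (hσ : 2 < σ) : 0 < ssAlpha m σ := by
  unfold ssAlpha
  have : 0 < (σ - 2) * (m - 1) := mul_pos (by linarith) (by linarith)
  exact div_pos (by linarith) this

theorem ssBeta_pos {σ : ℝ} (hσ : 2 < σ) : 0 < ssBeta σ := div_pos two_pos (by linarith)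

/-! ### Invariant planes, and instability of the critical point inside {X = 0}. -/

section Trajectory

variable {m σ l : ℝ} {X Y Z : ℝ → ℝ} {I : Set ℝ}

theorem IsTrajectory.continuousOn_X (h : IsTrajectory m σ X Y Z I) : ContinuousOn X I :=
  fun η hη => (h.hasDerivAt_X η hη).continuousAt.continuousWithinAt

theorem IsTrajectory.continuousOn_Y (h : IsTrajectory m σ X Y Z I) : ContinuousOn Y I :=
  fun η hη => (h.hasDerivAt_Y η hη).continuousAt.continuousWithinAt

theorem IsTrajectory.X_eq_zero (h : IsTrajectory m σ X Y Z I) {s t : ℝ} (hs : s ∈ I) (ht : t ∈ I)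
    (h0 : X s = 0) : X t = 0 :=
  eq_zero_of_hasDerivAt_mul h.ordConnected (a := fun η => (m - 1) * Y η - 2 * X η)
    (fun η hη => (h.hasDerivAt_X η hη).congr_deriv (mul_comm _ _))
    ((h.continuousOn_Y.const_mul _).sub (h.continuousOn_X.const_mul _)) hs ht h0

theorem IsTrajectory.Z_eq_zero (h : IsTrajectory m σ X Y Z I) {s t : ℝ} (hs : s ∈ I) (ht : t ∈ I)
    (h0 : Z s = 0) : Z t = 0 :=
  eq_zero_of_hasDerivAt_mul h.ordConnected (a := fun η => (σ - 2) * X η)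
    (fun η hη => h.hasDerivAt_Z η hη)
    (h.continuousOn_X.const_mul _) hs ht h0

theorem Enters.tendsto_X {P : ℝ × ℝ × ℝ} (h : Enters X Y Z I P) : Tendsto X atTop (𝓝 P.1) :=
  (continuous_fst.tendsto P).comp h.tendsto

theorem Enters.tendsto_Y {P : ℝ × ℝ × ℝ} (h : Enters X Y Z I P) : Tendsto Y atTop (𝓝 P.2.1) :=
  ((continuous_fst.comp continuous_snd).tendsto P).comp h.tendsto

theorem Enters.tendsto_Z {P : ℝ × ℝ × ℝ} (h : Enters X Y Z I P) : Tendsto Z atTop (𝓝 P.2.2) :=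
  ((continuous_snd.comp continuous_snd).tendsto P).comp h.tendsto

theorem Enters.eventually_mem {P : ℝ × ℝ × ℝ} (h : Enters X Y Z I P) : ∀ᶠ η in atTop, η ∈ I := by
  obtain ⟨c, hc⟩ := h.mem_atTop
  filter_upwards [eventually_ge_atTop c] with η hη using hc hη

/-- An orbit in the invariant plane `{X = 0}` cannot enter `P₀^λ`, which is unstable there. -/
theorem IsTrajectory.X_ne_zero (h : IsTrajectory m σ X Y Z I)
    (he : Enters X Y Z I (critPoint m σ l)) (hl : 2 * l < -(ssBeta σ / ssAlpha m σ)) {s : ℝ}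
    (hs : s ∈ I) : X s ≠ 0 := by
  intro h0
  set b := ssBeta σ / ssAlpha m σ with hb
  have hX : ∀ t ∈ I, X t = 0 := fun t ht => h.X_eq_zero hs ht h0
  have hZder : ∀ t ∈ I, HasDerivAt Z 0 t := fun t ht =>
    (h.hasDerivAt_Z t ht).congr_deriv (by rw [hX t ht]; ring)
  have hZmono := monotoneOn_of_hasDerivAt_nonneg h.ordConnected hZder (fun _ _ => le_rfl)
  have hZanti := antitoneOn_of_hasDerivAt_nonpos h.ordConnected hZder (fun _ _ => le_rfl)
  have hZ : ∀ t ∈ I, Z t = -l ^ 2 - b * l := by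
    intro t ht
    have h1 : Tendsto Z atTop (𝓝 (Z t)) := by
      refine tendsto_const_nhds.congr' ?_
      filter_upwards [he.eventually_mem, eventually_ge_atTop t] with η hη hη'
      exact le_antisymm (hZmono ht hη hη') (hZanti ht hη hη')
    exact tendsto_nhds_unique h1 he.tendsto_Z
  -- For the limit value of Z, the quadratic in Y has roots λ and -b - λ, and the second lies above
  -- the first.
  have hY' : ∀ t ∈ I, HasDerivAt (fun η => Y η - l) (-(Y t + l + b) * (Y t - l)) t := fun t ht =>
    ((h.hasDerivAt_Y t ht).sub_const l).congr_deriv (by rw [hX t ht, hZ t ht]; ring)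
  have hYlim : Tendsto Y atTop (𝓝 l) := he.tendsto_Y
  have hYl : ∀ t ∈ I, Y t = l := by
    obtain ⟨c, hc⟩ := he.mem_atTop
    have hev : ∀ᶠ η in atTop, Y η < -b - l := hYlim.eventually_lt_const (by linarith)
    obtain ⟨c', hc'⟩ := eventually_atTop.mp hev
    set d := max c c'
    -- While Y < -b - λ the squared distance from Y to λ cannot decrease; since it tends to 0, it is
    -- 0.
    have hd : ∀ η ∈ Ici d, HasDerivAt (fun η => (Y η - l) ^ 2)
        (2 * (-(Y η + l + b)) * (Y η - l) ^ 2) η := by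
      intro η hη
      refine ((hY' η (hc ((le_max_left c c').trans hη))).pow 2).congr_deriv ?_
      simp only [Nat.cast_ofNat]
      ring
    have hmono := monotoneOn_of_hasDerivAt_nonneg ordConnected_Ici hd (fun η hη => by
      have := hc' η ((le_max_right c c').trans hη)
      exact mul_nonneg (by linarith) (sq_nonneg _))
    have hlim : Tendsto (fun η => (Y η - l) ^ 2) atTop (𝓝 0) := by
      simpa using (hYlim.sub_const l).pow 2
    have hle : (Y d - l) ^ 2 ≤ 0 := by
      refine ge_of_tendsto hlim ?_
      filter_upwards [eventually_ge_atTop d] with η hη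
      exact hmono self_mem_Ici hη hη
    have hd0 : Y d - l = 0 := pow_eq_zero_iff two_ne_zero |>.mp (le_antisymm hle (sq_nonneg _))
    intro t ht
    have := eq_zero_of_hasDerivAt_mul h.ordConnected (a := fun t => -(Y t + l + b)) hY'
      (((h.continuousOn_Y.add_const l).add_const b).neg) (hc (le_max_left c c')) ht hd0
    linarith
  obtain ⟨η, hη, hne⟩ := he.nontrivial
  refine hne ?_
  simp only [critPoint, Prod.mk.injEq]
  exact ⟨hX η hη, hYl η hη, hZ η hη⟩

end Trajectory

/-- An orbit lying in the open octant `X > 0`, `Y < 0`, `Z > 0` on the half-line `(a, ∞)`, together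
with the radius `r` and the amplitude `φ` of the corresponding profile, in the case where the
profile vanishes at `ξ₀`. -/
structure RadialOrbit (m σ α β l ξ₀ a : ℝ) (X Y Z r φ : ℝ → ℝ) : Prop where
  hasDerivAt_Y : ∀ η ∈ Ioi a, HasDerivAt Y
    (-(Y η) ^ 2 - β / α * Y η + X η - X η * Y η - Z η) η
  X_pos : ∀ η ∈ Ioi a, 0 < X η
  Y_neg : ∀ η ∈ Ioi a, Y η < 0
  Z_pos : ∀ η ∈ Ioi a, 0 < Z η
  r_pos : ∀ η ∈ Ioi a, 0 < r η
  φ_pos : ∀ η ∈ Ioi a, 0 < φ η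
  hasDerivAt_r : ∀ η ∈ Ioi a, HasDerivAt r (r η * X η) η
  hasDerivAt_φ : ∀ η ∈ Ioi a, HasDerivAt φ (φ η * Y η) η
  X_eq : ∀ η ∈ Ioi a, X η = m / α * (r η ^ 2)⁻¹ * φ η ^ (m - 1)
  Z_eq : ∀ η ∈ Ioi a, Z η = m / α ^ 2 * r η ^ (σ - 2)
  tendsto_Y : Tendsto Y atTop (𝓝 l)
  tendsto_r : Tendsto r atTop (𝓝 ξ₀)
  tendsto_φ : Tendsto φ atTop (𝓝 0)

/-! ### Signs along an entering orbit, and the passage to radius and amplitude. -/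

section Entering

variable {m σ l : ℝ} {X Y Z : ℝ → ℝ} {I : Set ℝ}

theorem IsOrbit.X_pos (h : IsOrbit m σ X Y Z I) (he : Enters X Y Z I (critPoint m σ l))
    (hl : 2 * l < -(ssBeta σ / ssAlpha m σ)) : ∀ η ∈ I, 0 < X η := fun η hη =>
  lt_of_le_of_ne (h.nonneg_X η hη) (h.isTrajectory.X_ne_zero he hl hη).symm

/-- The plane {Z = 0} is invariant, but the limit of Z is positive. -/
theorem IsOrbit.Z_pos (h : IsOrbit m σ X Y Z I) (he : Enters X Y Z I (critPoint m σ l))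
    (hl0 : 0 < -l ^ 2 - ssBeta σ / ssAlpha m σ * l) : ∀ η ∈ I, 0 < Z η := by
  refine fun η hη => lt_of_le_of_ne (h.nonneg_Z η hη) fun h0 => ?_
  have h1 : Tendsto Z atTop (𝓝 0) := by
    refine tendsto_const_nhds.congr' ?_
    filter_upwards [he.eventually_mem] with t ht
    exact (h.isTrajectory.Z_eq_zero hη ht h0.symm).symm
  have := tendsto_nhds_unique h1 he.tendsto_Z
  simp only [critPoint] at this
  linarith

theorem IsOrbit.Z_lt (hσ : 2 < σ) (h : IsOrbit m σ X Y Z I)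
    (he : Enters X Y Z I (critPoint m σ l)) (hX : ∀ η ∈ I, 0 < X η) (hZ : ∀ η ∈ I, 0 < Z η) :
    ∀ η ∈ I, Z η < -l ^ 2 - ssBeta σ / ssAlpha m σ * l := by
  have hmono := strictMonoOn_of_hasDerivAt_pos h.isTrajectory.ordConnected
    h.isTrajectory.hasDerivAt_Z
    (fun η hη => mul_pos (mul_pos (by linarith) (hX η hη)) (hZ η hη))
  intro η hη
  obtain ⟨c, hc⟩ := he.mem_atTop
  have hd : max c (η + 1) ∈ I := hc (le_max_left c _)
  have h1 : Z η < Z (max c (η + 1)) := hmono hη hd (by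
    have := le_max_right c (η + 1); linarith)
  refine h1.trans_le (ge_of_tendsto he.tendsto_Z ?_)
  filter_upwards [eventually_ge_atTop (max c (η + 1))] with t ht
  exact hmono.monotoneOn hd (hc ((le_max_left c _).trans ht)) ht

/-- The plane `Y = -β/(2α)` can only be crossed upwards. -/
theorem IsOrbit.Y_lt (hb : 0 < ssBeta σ / ssAlpha m σ) (h : IsOrbit m σ X Y Z I)
    (he : Enters X Y Z I (critPoint m σ l)) (hl : 2 * l < -(ssBeta σ / ssAlpha m σ))
    (hX : ∀ η ∈ I, 0 < X η)
    (hZ : ∀ η ∈ I, Z η < -l ^ 2 - ssBeta σ / ssAlpha m σ * l) :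
    ∀ η ∈ I, Y η < -(ssBeta σ / ssAlpha m σ) / 2 := by
  set b := ssBeta σ / ssAlpha m σ with hbdef
  intro η hη
  by_contra hc
  push Not at hc
  obtain ⟨c, hcI⟩ := he.mem_atTop
  have hge : ∀ t, η ≤ t → t ∈ I → -b / 2 ≤ Y t := by
    intro t ht htI
    have hsub : Icc η t ⊆ I := h.isTrajectory.ordConnected.out hη htI
    -- Barrier argument for -Y: wherever Y = -b/2, Y' = b²/4 + X(1 + b/2) - Z > (λ + b/2)² ≥ 0.
    have hYt := image_le_of_deriv_right_lt_deriv_boundary (f := fun s => -Y s)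
      (f' := fun s => -(-(Y s) ^ 2 - b * Y s + X s - X s * Y s - Z s)) (a := η) (b := t)
      (B := fun _ => b / 2) (B' := fun _ => 0)
      ((h.isTrajectory.continuousOn_Y.mono hsub).neg)
      (fun s hs => (h.isTrajectory.hasDerivAt_Y s (hsub (Ico_subset_Icc_self hs))).neg.hasDerivWithinAt)
      (by linarith) (fun s => hasDerivAt_const s _)
      (fun s hs hs' => by
        have hsI := hsub (Ico_subset_Icc_self hs)
        have h1 : Y s = -b / 2 := by linarith
        have h2 := hX s hsI
        have h3 := hZ s hsI
        rw [h1]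
        nlinarith [sq_nonneg (l + b / 2), mul_pos h2 hb])
      (right_mem_Icc.mpr ht)
    linarith
  have hlim : -b / 2 ≤ l := by
    refine ge_of_tendsto he.tendsto_Y ?_
    filter_upwards [eventually_ge_atTop c, eventually_ge_atTop η] with t ht ht'
    exact hge t ht' (hcI ht)
  linarith

/-- Since Y < 0, the derivative of 1/X is at least 2, so going backwards 1/X would become negative
in finite time. -/
theorem IsOrbit.exists_eq_Ioi (hm : 1 < m) (h : IsOrbit m σ X Y Z I)
    (he : Enters X Y Z I (critPoint m σ l)) (hX : ∀ η ∈ I, 0 < X η) (hY : ∀ η ∈ I, Y η < 0) :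
    ∃ a, I = Ioi a := by
  obtain ⟨c, hc⟩ := he.mem_atTop
  have hder : ∀ η ∈ I, HasDerivAt (fun η => (X η)⁻¹ - 2 * η) (-((m - 1) * Y η) / X η) η := by
    intro η hη
    have hne := (hX η hη).ne'
    refine (((h.isTrajectory.hasDerivAt_X η hη).inv hne).sub
      ((hasDerivAt_id η).const_mul 2)).congr_deriv ?_
    field_simp
    ring
  have hmono := monotoneOn_of_hasDerivAt_nonneg h.isTrajectory.ordConnected hder (fun η hη =>
    div_nonneg (by nlinarith [hY η hη]) (hX η hη).le)
  have hbdd : BddBelow I := by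
    refine ⟨min c (c - (X c)⁻¹ / 2), fun η hη => ?_⟩
    rcases le_total c η with h1 | h1
    · exact (min_le_left _ _).trans h1
    · have h2 := hmono hη (hc self_mem_Ici) h1
      have h3 := inv_pos.mpr (hX η hη)
      simp only at h2
      exact (min_le_right _ _).trans (by linarith)
  refine ⟨sInf I, Subset.antisymm (fun η hη => ?_) (fun η hη => ?_)⟩
  · refine lt_of_le_of_ne (csInf_le hbdd hη) fun heq => ?_
    obtain ⟨δ, hδ, hsub⟩ := Metric.isOpen_iff.mp h.isTrajectory.isOpen η hη
    have h1 : η - δ / 2 ∈ I := hsub (by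
      rw [Metric.mem_ball, Real.dist_eq, abs_lt]
      constructor <;> linarith)
    have := csInf_le hbdd h1
    linarith
  · obtain ⟨t, htI, ht⟩ := exists_lt_of_csInf_lt h.isTrajectory.nonempty hη
    exact h.isTrajectory.ordConnected.out htI (hc (le_max_left c η)) ⟨ht.le, le_max_right c η⟩

/-- The radius and the amplitude of the profile carried by an orbit entering `P₀^λ`. -/
theorem IsOrbit.exists_radialOrbit (hm : 1 < m) (hσ : 2 < σ)
    (hl1 : -(ssBeta σ / ssAlpha m σ) < l) (hl2 : 2 * l < -(ssBeta σ / ssAlpha m σ))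
    (h : IsOrbit m σ X Y Z I) (he : Enters X Y Z I (critPoint m σ l)) :
    ∃ a ξ₀ : ℝ, ∃ r φ : ℝ → ℝ, I = Ioi a ∧ 0 < ξ₀ ∧
      RadialOrbit m σ (ssAlpha m σ) (ssBeta σ) l ξ₀ a X Y Z r φ := by
  have hα := ssAlpha_pos hm hσ
  have hb : 0 < ssBeta σ / ssAlpha m σ := div_pos (ssBeta_pos hσ) hα
  have hZ0 : 0 < -l ^ 2 - ssBeta σ / ssAlpha m σ * l := by nlinarith
  have hX := h.X_pos he hl2
  have hZ := h.Z_pos he hZ0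
  have hY : ∀ η ∈ I, Y η < 0 := fun η hη =>
    (h.Y_lt hb he hl2 hX (h.Z_lt hσ he hX hZ) η hη).trans (by linarith)
  obtain ⟨a, rfl⟩ := h.exists_eq_Ioi hm he hX hY
  set α := ssAlpha m σ with hαdef
  set Z₀ := -l ^ 2 - ssBeta σ / α * l with hZ₀def
  -- The formulas expressing Z and X through the profile, solved for ξ and f.
  set r : ℝ → ℝ := fun η => (α ^ 2 / m * Z η) ^ (σ - 2)⁻¹ with hr
  set φ : ℝ → ℝ := fun η => (α / m * (r η ^ 2 * X η)) ^ (m - 1)⁻¹ with hφ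
  have hm0 : 0 < m := by linarith
  have hm1 : m - 1 ≠ 0 := by linarith
  have hσ2 : σ - 2 ≠ 0 := by linarith
  have hrb : ∀ η ∈ Ioi a, 0 < α ^ 2 / m * Z η := fun η hη =>
    mul_pos (by positivity) (hZ η hη)
  have hrpos : ∀ η ∈ Ioi a, 0 < r η := fun η hη => Real.rpow_pos_of_pos (hrb η hη) _
  have hφb : ∀ η ∈ Ioi a, 0 < α / m * (r η ^ 2 * X η) := fun η hη =>
    mul_pos (by positivity) (mul_pos (pow_pos (hrpos η hη) 2) (hX η hη))
  have hφpos : ∀ η ∈ Ioi a, 0 < φ η := fun η hη => Real.rpow_pos_of_pos (hφb η hη) _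
  have hrd : ∀ η ∈ Ioi a, HasDerivAt r (r η * X η) η := by
    intro η hη
    have h1 := ((h.isTrajectory.hasDerivAt_Z η hη).const_mul (α ^ 2 / m)).rpow_const
      (p := (σ - 2)⁻¹) (Or.inl (hrb η hη).ne')
    refine h1.congr_deriv ?_
    rw [Real.rpow_sub_one (hrb η hη).ne']
    have := (hZ η hη).ne'
    simp only [hr]
    field_simp
  have hφd : ∀ η ∈ Ioi a, HasDerivAt φ (φ η * Y η) η := by
    intro η hη
    have h1 := ((((hrd η hη).pow 2).mul (h.isTrajectory.hasDerivAt_X η hη)).const_mul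
      (α / m)).rpow_const (p := (m - 1)⁻¹) (Or.inl (hφb η hη).ne')
    refine h1.congr_deriv ?_
    have e : (α / m * (r ^ 2 * X) η) = α / m * (r η ^ 2 * X η) := rfl
    rw [e, Real.rpow_sub_one (hφb η hη).ne']
    have := (hX η hη).ne'
    have := (hrpos η hη).ne'
    simp only [hφ, Pi.pow_apply]
    field_simp
    ring
  have hZlim : Tendsto Z atTop (𝓝 Z₀) := he.tendsto_Z
  have hrlim : Tendsto r atTop (𝓝 ((α ^ 2 / m * Z₀) ^ (σ - 2)⁻¹)) :=
    (hZlim.const_mul _).rpow_const (Or.inl (by positivity))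
  refine ⟨a, (α ^ 2 / m * Z₀) ^ (σ - 2)⁻¹, r, φ, rfl, by positivity, ?_⟩
  refine ⟨h.isTrajectory.hasDerivAt_Y, hX, hY, hZ, hrpos, hφpos, hrd, hφd, ?_, ?_, he.tendsto_Y,
    hrlim, ?_⟩
  · intro η hη
    have := (hrpos η hη).ne'
    rw [hφ]
    simp only
    rw [Real.rpow_inv_rpow (hφb η hη).le hm1]
    field_simp
  · intro η hη
    rw [hr]
    simp only
    rw [Real.rpow_inv_rpow (hrb η hη).le hσ2]
    field_simp
  -- The amplitude tends to 0 because X does and the radius stays bounded.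
  · have h1 : Tendsto φ atTop
        (𝓝 ((α / m * (((α ^ 2 / m * Z₀) ^ (σ - 2)⁻¹) ^ 2 * 0)) ^ (m - 1)⁻¹)) :=
      (((hrlim.pow 2).mul he.tendsto_X).const_mul _).rpow_const
        (Or.inr (inv_nonneg.mpr (by linarith)))
    have e : ((α / m * (((α ^ 2 / m * Z₀) ^ (σ - 2)⁻¹) ^ 2 * 0)) ^ (m - 1)⁻¹ : ℝ) = 0 := by
      rw [mul_zero, mul_zero, Real.zero_rpow (inv_ne_zero hm1)]
    rwa [e] at h1

end Entering

/-- A local version of `hasDerivAt_of_hasDerivAt_of_ne`. -/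
theorem hasDerivAt_of_eventually_of_ne {f g : ℝ → ℝ} {x : ℝ}
    (hfg : ∀ᶠ y in 𝓝 x, y ≠ x → HasDerivAt f (g y) y) (hf : ContinuousAt f x)
    (hg : ContinuousAt g x) : HasDerivAt f (g x) x := by
  obtain ⟨u, v, hx, huv⟩ := mem_nhds_iff_exists_Ioo_subset.mp hfg
  have hr : ∀ y ∈ Ioo x v, HasDerivAt f (g y) y := fun y hy =>
    huv ⟨hx.1.trans hy.1, hy.2⟩ hy.1.ne'
  have hl : ∀ y ∈ Ioo u x, HasDerivAt f (g y) y := fun y hy =>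
    huv ⟨hy.1, hy.2.trans hx.2⟩ hy.2.ne
  have hrn : Ioo x v ∈ 𝓝[>] x := Ioo_mem_nhdsGT hx.2
  have hln : Ioo u x ∈ 𝓝[<] x := Ioo_mem_nhdsLT hx.1
  have h1 : HasDerivWithinAt f (g x) (Ici x) x := by
    refine hasDerivWithinAt_Ici_of_tendsto_deriv
      (fun y hy => (hr y hy).differentiableAt.differentiableWithinAt) hf.continuousWithinAt hrn ?_
    refine (hg.tendsto.mono_left nhdsWithin_le_nhds).congr' ?_
    filter_upwards [hrn] with y hy using (hr y hy).deriv.symm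
  have h2 : HasDerivWithinAt f (g x) (Iic x) x := by
    refine hasDerivWithinAt_Iic_of_tendsto_deriv
      (fun y hy => (hl y hy).differentiableAt.differentiableWithinAt) hf.continuousWithinAt hln ?_
    refine (hg.tendsto.mono_left nhdsWithin_le_nhds).congr' ?_
    filter_upwards [hln] with y hy using (hl y hy).deriv.symm
  simpa using h2.union h1

/-! ### Flux monotonicity, a priori bounds, and the left end of the orbit. -/

section Radial

variable {m σ α β l ξ₀ a : ℝ} {X Y Z r φ : ℝ → ℝ}

namespace RadialOrbit

theorem strictMonoOn_r (H : RadialOrbit m σ α β l ξ₀ a X Y Z r φ) : StrictMonoOn r (Ioi a) :=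
  strictMonoOn_of_hasDerivAt_pos ordConnected_Ioi H.hasDerivAt_r
    (fun η hη => mul_pos (H.r_pos η hη) (H.X_pos η hη))

theorem strictAntiOn_φ (H : RadialOrbit m σ α β l ξ₀ a X Y Z r φ) : StrictAntiOn φ (Ioi a) :=
  strictAntiOn_of_hasDerivAt_neg ordConnected_Ioi H.hasDerivAt_φ
    (fun η hη => mul_neg_of_pos_of_neg (H.φ_pos η hη) (H.Y_neg η hη))

theorem r_lt (H : RadialOrbit m σ α β l ξ₀ a X Y Z r φ) : ∀ η ∈ Ioi a, r η < ξ₀ := by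
  intro η hη
  have h1 : η + 1 ∈ Ioi a := lt_trans hη (lt_add_one η)
  refine (H.strictMonoOn_r hη h1 (lt_add_one η)).trans_le (ge_of_tendsto H.tendsto_r ?_)
  filter_upwards [eventually_ge_atTop (η + 1)] with t ht
  exact H.strictMonoOn_r.monotoneOn h1 (lt_of_lt_of_le h1 ht) ht

/-- With ξ = r and f = φ, the product αrφY is (f^m)'. Subtracting αξf cancels the term αf of the
equation, and adding (α+β)ξ₀f gives the remaining f' a coefficient of fixed sign. -/
theorem hasDerivAt_flux (hα : 0 < α) (H : RadialOrbit m σ α β l ξ₀ a X Y Z r φ) :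
    ∀ η ∈ Ioi a, HasDerivAt (fun η => φ η * (α * r η * Y η - α * r η + (α + β) * ξ₀))
      (φ η * ((α + β) * (ξ₀ - r η) * Y η - α * r η * Z η)) η := by
  intro η hη
  have h1 := (((((H.hasDerivAt_r η hη).const_mul α).mul (H.hasDerivAt_Y η hη)).sub
    ((H.hasDerivAt_r η hη).const_mul α)).add_const ((α + β) * ξ₀))
  refine ((H.hasDerivAt_φ η hη).mul h1).congr_deriv ?_
  simp only [Pi.sub_apply, Pi.mul_apply]
  field_simp
  ring

theorem strictAntiOn_flux (hα : 0 < α) (hβ : 0 < β) (H : RadialOrbit m σ α β l ξ₀ a X Y Z r φ) :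
    StrictAntiOn (fun η => φ η * (α * r η * Y η - α * r η + (α + β) * ξ₀)) (Ioi a) :=
  strictAntiOn_of_hasDerivAt_neg ordConnected_Ioi (H.hasDerivAt_flux hα) fun η hη => by
    have h1 := H.r_lt η hη
    have h2 : (α + β) * (ξ₀ - r η) * Y η < 0 :=
      mul_neg_of_pos_of_neg (mul_pos (by linarith) (by linarith)) (H.Y_neg η hη)
    have h3 : 0 < α * r η * Z η := mul_pos (mul_pos hα (H.r_pos η hη)) (H.Z_pos η hη)
    exact mul_neg_of_pos_of_neg (H.φ_pos η hη) (by linarith)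

/-- A strictly decreasing quantity with limit 0 is positive; dividing by φ leaves a lower bound on
rY. -/
theorem flux_pos (hα : 0 < α) (hβ : 0 < β) (H : RadialOrbit m σ α β l ξ₀ a X Y Z r φ) :
    ∀ η ∈ Ioi a, 0 < α * r η * Y η - α * r η + (α + β) * ξ₀ := by
  intro η hη
  have h1 : η + 1 ∈ Ioi a := lt_trans hη (lt_add_one η)
  have hlim : Tendsto (fun η => φ η * (α * r η * Y η - α * r η + (α + β) * ξ₀)) atTop (𝓝 0) := by
    have := H.tendsto_φ.mul ((((H.tendsto_r.const_mul α).mul H.tendsto_Y).sub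
      (H.tendsto_r.const_mul α)).add_const ((α + β) * ξ₀))
    simpa using this
  have hanti := H.strictAntiOn_flux hα hβ
  have h2 := hanti hη h1 (lt_add_one η)
  have h3 : 0 ≤ φ (η + 1) * (α * r (η + 1) * Y (η + 1) - α * r (η + 1) + (α + β) * ξ₀) := by
    refine le_of_tendsto hlim ?_
    filter_upwards [eventually_ge_atTop (η + 1)] with t ht
    exact hanti.antitoneOn h1 (lt_of_lt_of_le h1 ht) ht
  exact pos_of_mul_pos_right (h3.trans_lt h2) (H.φ_pos η hη).le

/-- A universal bound on the amplitude, from the Lipschitz bound on the pressure `f^(m-1)`. -/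
theorem φ_rpow_le (hm : 1 < m) (hα : 0 < α) (hβ : 0 < β)
    (H : RadialOrbit m σ α β l ξ₀ a X Y Z r φ) :
    ∀ η ∈ Ioi a, φ η ^ (m - 1) ≤ (m - 1) * (α + β) * ξ₀ / m * ξ₀ := by
  -- Along the orbit d(φ^(m-1))/dr = (m-1)αrY/m, so the lower bound on rY makes this sum
  -- nondecreasing.
  have hd : ∀ η ∈ Ioi a, HasDerivAt
      (fun η => φ η ^ (m - 1) + (m - 1) * (α + β) * ξ₀ / m * r η)
      ((m - 1) / m * (r η * X η) * (α * r η * Y η + (α + β) * ξ₀)) η := by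
    intro η hη
    have hφ := H.φ_pos η hη
    have hr := H.r_pos η hη
    refine (((H.hasDerivAt_φ η hη).rpow_const (p := m - 1) (Or.inl hφ.ne')).add
      ((H.hasDerivAt_r η hη).const_mul _)).congr_deriv ?_
    rw [H.X_eq η hη, Real.rpow_sub_one hφ.ne']
    field_simp
  have hmono := monotoneOn_of_hasDerivAt_nonneg ordConnected_Ioi hd fun η hη => by
    have h1 := H.flux_pos hα hβ η hη
    have h2 : 0 < α * r η := mul_pos hα (H.r_pos η hη)
    exact mul_nonneg (mul_nonneg (div_nonneg (by linarith) (by linarith))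
      (mul_pos (H.r_pos η hη) (H.X_pos η hη)).le) (by linarith)
  have hlim : Tendsto (fun η => φ η ^ (m - 1) + (m - 1) * (α + β) * ξ₀ / m * r η) atTop
      (𝓝 ((m - 1) * (α + β) * ξ₀ / m * ξ₀)) := by
    have := (H.tendsto_φ.rpow_const (p := m - 1) (Or.inr (by linarith))).add
      (H.tendsto_r.const_mul ((m - 1) * (α + β) * ξ₀ / m))
    rwa [Real.zero_rpow (by linarith), zero_add] at this
  intro η hη
  have h1 : φ η ^ (m - 1) + (m - 1) * (α + β) * ξ₀ / m * r η ≤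
      (m - 1) * (α + β) * ξ₀ / m * ξ₀ := by
    refine ge_of_tendsto hlim ?_
    filter_upwards [eventually_ge_atTop η] with t ht
    exact hmono hη (lt_of_lt_of_le hη ht) ht
  have hξ : 0 < ξ₀ := (H.r_pos η hη).trans (H.r_lt η hη)
  have h2 : 0 ≤ (m - 1) * (α + β) * ξ₀ / m * r η :=
    mul_nonneg (div_nonneg (mul_nonneg (mul_nonneg (by linarith) (by linarith)) hξ.le)
      (by linarith)) (H.r_pos η hη).le
  linarith

theorem exists_φ_le (hm : 1 < m) (hα : 0 < α) (hβ : 0 < β)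
    (H : RadialOrbit m σ α β l ξ₀ a X Y Z r φ) : ∃ M, ∀ η ∈ Ioi a, φ η ≤ M := by
  refine ⟨((m - 1) * (α + β) * ξ₀ / m * ξ₀) ^ (m - 1)⁻¹, fun η hη => ?_⟩
  have hφ := H.φ_pos η hη
  rw [Real.le_rpow_inv_iff_of_pos hφ.le ?_ (by linarith)]
  · exact H.φ_rpow_le hm hα hβ η hη
  · exact (Real.rpow_nonneg hφ.le _).trans (H.φ_rpow_le hm hα hβ η hη)

/-- The amplitude has a positive limit at the left end of the interval. -/
theorem exists_tendsto_φ (hm : 1 < m) (hα : 0 < α) (hβ : 0 < β)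
    (H : RadialOrbit m σ α β l ξ₀ a X Y Z r φ) :
    ∃ A, 0 < A ∧ Tendsto φ (𝓝[>] a) (𝓝 A) := by
  obtain ⟨M, hM⟩ := H.exists_φ_le hm hα hβ
  have hbdd : BddAbove (φ '' Ioi a) := ⟨M, by rintro _ ⟨η, hη, rfl⟩; exact hM η hη⟩
  refine ⟨_, ?_, H.strictAntiOn_φ.antitoneOn.tendsto_nhdsGT hbdd⟩
  have h1 : a + 1 ∈ Ioi a := lt_add_one a
  exact (H.φ_pos _ h1).trans_le (le_csSup hbdd (mem_image_of_mem _ h1))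

theorem exists_tendsto_r (H : RadialOrbit m σ α β l ξ₀ a X Y Z r φ) :
    ∃ ρ, 0 ≤ ρ ∧ Tendsto r (𝓝[>] a) (𝓝 ρ) := by
  have hbdd : BddBelow (r '' Ioi a) := ⟨0, by rintro _ ⟨η, hη, rfl⟩; exact (H.r_pos η hη).le⟩
  refine ⟨_, ?_, H.strictMonoOn_r.monotoneOn.tendsto_nhdsGT hbdd⟩
  exact le_csInf (nonempty_Ioi.image _) (by rintro _ ⟨η, hη, rfl⟩; exact (H.r_pos η hη).le)

/-- The decreasing flux quantity is bounded above, hence converges at a; rY is recovered from it by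
dividing by φ, whose limit is positive. -/
theorem exists_tendsto_r_mul_Y (hm : 1 < m) (hα : 0 < α) (hβ : 0 < β)
    (H : RadialOrbit m σ α β l ξ₀ a X Y Z r φ) :
    ∃ y, Tendsto (fun η => r η * Y η) (𝓝[>] a) (𝓝 y) := by
  obtain ⟨M, hM⟩ := H.exists_φ_le hm hα hβ
  obtain ⟨A, hA, hφ⟩ := H.exists_tendsto_φ hm hα hβ
  obtain ⟨ρ, hρ, hr⟩ := H.exists_tendsto_r
  have hq := (H.strictAntiOn_flux hα hβ).antitoneOn.tendsto_nhdsGT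
    ⟨M * ((α + β) * ξ₀), by
      rintro _ ⟨η, hη, rfl⟩
      have h1 := mul_pos hα (H.r_pos η hη)
      have h2 := mul_neg_of_pos_of_neg h1 (H.Y_neg η hη)
      have hξ : 0 < ξ₀ := (H.r_pos η hη).trans (H.r_lt η hη)
      calc φ η * (α * r η * Y η - α * r η + (α + β) * ξ₀)
          ≤ φ η * ((α + β) * ξ₀) := mul_le_mul_of_nonneg_left (by linarith) (H.φ_pos η hη).le
        _ ≤ M * ((α + β) * ξ₀) := mul_le_mul_of_nonneg_right (hM η hη)
            (mul_pos (by linarith) hξ).le⟩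
  have h1 := (((hq.div hφ hA.ne').add (hr.const_mul α)).sub_const ((α + β) * ξ₀)).const_mul α⁻¹
  refine ⟨_, h1.congr' ?_⟩
  filter_upwards [self_mem_nhdsWithin] with η hη
  have := (H.φ_pos η hη).ne'
  simp only [Pi.div_apply]
  field_simp
  ring

end RadialOrbit

/-- A maximal trajectory on `(a, ∞)` has no limit at `a`. -/
theorem IsOrbit.not_tendsto_nhdsGT (h : IsOrbit m σ X Y Z (Ioi a)) {x y z : ℝ}
    (hX : Tendsto X (𝓝[>] a) (𝓝 x)) (hY : Tendsto Y (𝓝[>] a) (𝓝 y))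
    (hZ : Tendsto Z (𝓝[>] a) (𝓝 z)) : False := by
  set b := ssBeta σ / ssAlpha m σ with hb
  set v : ℝ × ℝ × ℝ → ℝ × ℝ × ℝ := fun P =>
    (P.1 * ((m - 1) * P.2.1 - 2 * P.1),
      -(P.2.1) ^ 2 - b * P.2.1 + P.1 - P.1 * P.2.1 - P.2.2, (σ - 2) * P.1 * P.2.2) with hv
  have hvc : ContDiff ℝ 1 v := by
    rw [hv]; fun_prop
  -- Picard–Lindelöf at the limit point: the left half of this local solution, glued to the orbit,
  -- continues it past a.
  obtain ⟨w, hw0, ε, hε, hw⟩ :=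
    (hvc.contDiffAt (x := (x, y, z))).exists_forall_mem_closedBall_exists_eq_forall_mem_Ioo_hasDerivAt₀ a
  have key : ∀ (F g : ℝ → ℝ) (c : ℝ), g a = c → ContinuousAt g a → Tendsto F (𝓝[>] a) (𝓝 c) →
      ContinuousAt (fun t => if t ≤ a then g t else F t) a := by
    intro F g c hgc hg hF
    rw [continuousAt_iff_continuous_left'_right']
    constructor
    · simp only [ContinuousWithinAt, le_refl, if_true]
      refine (hg.tendsto.mono_left nhdsWithin_le_nhds).congr' ?_
      filter_upwards [self_mem_nhdsWithin] with t ht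
      rw [if_pos (le_of_lt ht)]
    · simp only [ContinuousWithinAt, le_refl, if_true, hgc]
      refine hF.congr' ?_
      filter_upwards [self_mem_nhdsWithin] with t ht
      rw [if_neg (not_le.mpr ht)]
  have haI : a ∈ Ioo (a - ε) (a + ε) := ⟨by linarith, by linarith⟩
  have hwc : ContinuousAt w a := (hw a haI).continuousAt
  set X' : ℝ → ℝ := fun t => if t ≤ a then (w t).1 else X t with hX'
  set Y' : ℝ → ℝ := fun t => if t ≤ a then (w t).2.1 else Y t with hY'
  set Z' : ℝ → ℝ := fun t => if t ≤ a then (w t).2.2 else Z t with hZ'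
  have hXc : ContinuousAt X' a := key X _ x (by rw [hw0]) hwc.fst hX
  have hYc : ContinuousAt Y' a := key Y _ y (by rw [hw0]) hwc.snd.fst hY
  have hZc : ContinuousAt Z' a := key Z _ z (by rw [hw0]) hwc.snd.snd hZ
  have hEl : ∀ t < a, (X' =ᶠ[𝓝 t] fun t => (w t).1) ∧ (Y' =ᶠ[𝓝 t] fun t => (w t).2.1) ∧
      (Z' =ᶠ[𝓝 t] fun t => (w t).2.2) := by
    intro t ht
    have := Iio_mem_nhds ht
    refine ⟨?_, ?_, ?_⟩ <;>
    · filter_upwards [this] with s hs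
      exact if_pos (le_of_lt hs)
  have hEr : ∀ t, a < t → (X' =ᶠ[𝓝 t] X) ∧ (Y' =ᶠ[𝓝 t] Y) ∧ (Z' =ᶠ[𝓝 t] Z) := by
    intro t ht
    have := Ioi_mem_nhds ht
    refine ⟨?_, ?_, ?_⟩ <;>
    · filter_upwards [this] with s hs
      exact if_neg (not_le.mpr hs)
  have hne : ∀ t ∈ Ioi (a - ε), t ≠ a →
      HasDerivAt X' (X' t * ((m - 1) * Y' t - 2 * X' t)) t ∧
      HasDerivAt Y' (-(Y' t) ^ 2 - b * Y' t + X' t - X' t * Y' t - Z' t) t ∧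
      HasDerivAt Z' ((σ - 2) * X' t * Z' t) t := by
    intro t ht hta
    rcases lt_or_gt_of_ne hta with hlt | hgt
    · obtain ⟨e1, e2, e3⟩ := hEl t hlt
      have hd := hw t ⟨ht, by linarith⟩
      rw [e1.eq_of_nhds, e2.eq_of_nhds, e3.eq_of_nhds]
      have hd1 : HasDerivAt (fun t => (w t).1) (v (w t)).1 t := hd.fst
      have hd2 : HasDerivAt (fun t => (w t).2.1) (v (w t)).2.1 t := hd.snd.fst
      have hd3 : HasDerivAt (fun t => (w t).2.2) (v (w t)).2.2 t := hd.snd.snd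
      exact ⟨hd1.congr_of_eventuallyEq e1, hd2.congr_of_eventuallyEq e2,
        hd3.congr_of_eventuallyEq e3⟩
    · obtain ⟨e1, e2, e3⟩ := hEr t hgt
      rw [e1.eq_of_nhds, e2.eq_of_nhds, e3.eq_of_nhds]
      exact ⟨(h.isTrajectory.hasDerivAt_X t hgt).congr_of_eventuallyEq e1,
        (h.isTrajectory.hasDerivAt_Y t hgt).congr_of_eventuallyEq e2,
        (h.isTrajectory.hasDerivAt_Z t hgt).congr_of_eventuallyEq e3⟩
  have htraj : IsTrajectory m σ X' Y' Z' (Ioi (a - ε)) := by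
    -- At a itself, continuity of the glued function and of its right-hand side upgrades the
    -- equation from both sides.
    have hglue : ∀ F G : ℝ → ℝ, (∀ t ∈ Ioi (a - ε), t ≠ a → HasDerivAt F (G t) t) →
        ContinuousAt F a → ContinuousAt G a → ∀ t ∈ Ioi (a - ε), HasDerivAt F (G t) t := by
      intro F G hFG hF hG t ht
      rcases eq_or_ne t a with rfl | hta
      · exact hasDerivAt_of_eventually_of_ne (mem_of_superset (Ioi_mem_nhds ht) hFG) hF hG
      · exact hFG t ht hta
    refine ⟨isOpen_Ioi, ordConnected_Ioi, nonempty_Ioi, ?_, ?_, ?_⟩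
    · exact hglue _ _ (fun t ht hta => (hne t ht hta).1) hXc
        (hXc.mul ((hYc.const_mul _).sub (hXc.const_mul _)))
    · exact hglue _ _ (fun t ht hta => (hne t ht hta).2.1) hYc
        (((((hYc.pow 2).neg.sub (hYc.const_mul _)).add hXc).sub (hXc.mul hYc)).sub hZc)
    · exact hglue _ _ (fun t ht hta => (hne t ht hta).2.2) hZc
        ((hXc.const_mul _).mul hZc)
  have := h.maximal X' Y' Z' (Ioi (a - ε)) htraj (Ioi_subset_Ioi (by linarith))
    (fun t ht => (hEr t ht).1.eq_of_nhds.symm) (fun t ht => (hEr t ht).2.1.eq_of_nhds.symm)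
    (fun t ht => (hEr t ht).2.2.eq_of_nhds.symm) (show a ∈ Ioi (a - ε) from by simp [hε])
  exact lt_irrefl a this

/-- On a maximal orbit the radius goes to `0` at the left end of the interval. -/
theorem RadialOrbit.tendsto_r_zero (hm : 1 < m) (hα : 0 < α) (hβ : 0 < β)
    (H : RadialOrbit m σ α β l ξ₀ a X Y Z r φ) (h : IsOrbit m σ X Y Z (Ioi a)) :
    Tendsto r (𝓝[>] a) (𝓝 0) := by
  obtain ⟨ρ, hρ, hr⟩ := H.exists_tendsto_r
  obtain ⟨A, hA, hφ⟩ := H.exists_tendsto_φ hm hα hβ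
  obtain ⟨y, hy⟩ := H.exists_tendsto_r_mul_Y hm hα hβ
  rcases hρ.eq_or_lt with h0 | hρ
  · rwa [← h0] at hr
  refine (h.not_tendsto_nhdsGT (x := m / α * (ρ ^ 2)⁻¹ * A ^ (m - 1)) (y := y / ρ)
    (z := m / α ^ 2 * ρ ^ (σ - 2)) ?_ ?_ ?_).elim
  · refine ((((hr.pow 2).inv₀ (pow_pos hρ 2).ne').const_mul _).mul
      (hφ.rpow_const (Or.inl hA.ne'))).congr' ?_
    filter_upwards [self_mem_nhdsWithin] with η hη using (H.X_eq η hη).symm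
  · refine (hy.div hr hρ.ne').congr' ?_
    filter_upwards [self_mem_nhdsWithin] with η hη
    have := (H.r_pos η hη).ne'
    simp only [Pi.div_apply]
    field_simp
  · refine ((hr.rpow_const (Or.inl hρ.ne')).const_mul _).congr' ?_
    filter_upwards [self_mem_nhdsWithin] with η hη using (H.Z_eq η hη).symm

end Radial

/-! ### The radius as independent variable. -/

section Inverse

variable {m σ α β l ξ₀ a : ℝ} {X Y Z r φ : ℝ → ℝ}

/-- `τ` is the inverse of the radius `r : (a, ∞) → (0, ξ₀)`. -/
structure IsRadialInverse (ξ₀ a : ℝ) (r τ : ℝ → ℝ) : Prop where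
  mem : ∀ ξ ∈ Ioo 0 ξ₀, τ ξ ∈ Ioi a
  right_inv : ∀ ξ ∈ Ioo 0 ξ₀, r (τ ξ) = ξ
  r_mem : ∀ η ∈ Ioi a, r η ∈ Ioo 0 ξ₀
  left_inv : ∀ η ∈ Ioi a, τ (r η) = η

theorem RadialOrbit.exists_radialInverse (H : RadialOrbit m σ α β l ξ₀ a X Y Z r φ)
    (h0 : Tendsto r (𝓝[>] a) (𝓝 0)) : ∃ τ, IsRadialInverse ξ₀ a r τ := by
  have himg : ∀ ξ ∈ Ioo 0 ξ₀, ∃ η ∈ Ioi a, r η = ξ := by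
    intro ξ hξ
    obtain ⟨s, hs, hsa⟩ := ((h0.eventually_lt_const hξ.1).and self_mem_nhdsWithin).exists
    obtain ⟨t, ht, hta⟩ :=
      ((H.tendsto_r.eventually_const_lt hξ.2).and (eventually_gt_atTop a)).exists
    have hc : ContinuousOn r (Ioi a) := fun η hη =>
      (H.hasDerivAt_r η hη).continuousAt.continuousWithinAt
    obtain ⟨η, hη, hη'⟩ := isPreconnected_Ioi.intermediate_value hsa hta hc ⟨hs.le, ht.le⟩
    exact ⟨η, hη, hη'⟩
  have hmem : ∀ η ∈ Ioi a, r η ∈ Ioo 0 ξ₀ := fun η hη => ⟨H.r_pos η hη, H.r_lt η hη⟩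
  choose! τ hτ using himg
  exact ⟨τ, fun ξ hξ => (hτ ξ hξ).1, fun ξ hξ => (hτ ξ hξ).2, hmem, fun η hη =>
    H.strictMonoOn_r.injOn (hτ _ (hmem η hη)).1 hη (hτ _ (hmem η hη)).2⟩

namespace IsRadialInverse

variable {τ : ℝ → ℝ}

theorem strictMonoOn (H : RadialOrbit m σ α β l ξ₀ a X Y Z r φ) (hτ : IsRadialInverse ξ₀ a r τ) :
    StrictMonoOn τ (Ioo 0 ξ₀) := by
  intro x hx y hy hxy
  by_contra hc
  push Not at hc
  have := H.strictMonoOn_r.monotoneOn (hτ.mem y hy) (hτ.mem x hx) hc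
  rw [hτ.right_inv x hx, hτ.right_inv y hy] at this
  linarith

theorem image_eq (hτ : IsRadialInverse ξ₀ a r τ) : τ '' Ioo 0 ξ₀ = Ioi a :=
  Subset.antisymm (by rintro _ ⟨ξ, hξ, rfl⟩; exact hτ.mem ξ hξ)
    fun η hη => ⟨r η, hτ.r_mem η hη, hτ.left_inv η hη⟩

theorem hasDerivAt (H : RadialOrbit m σ α β l ξ₀ a X Y Z r φ) (hτ : IsRadialInverse ξ₀ a r τ) :
    ∀ ξ ∈ Ioo 0 ξ₀, HasDerivAt τ (ξ * X (τ ξ))⁻¹ ξ := by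
  intro ξ hξ
  have hc : ContinuousAt τ ξ := (hτ.strictMonoOn H).continuousAt_of_image_mem_nhds
    (Ioo_mem_nhds hξ.1 hξ.2) (by rw [hτ.image_eq]; exact Ioi_mem_nhds (hτ.mem ξ hξ))
  have hd := H.hasDerivAt_r _ (hτ.mem ξ hξ)
  rw [hτ.right_inv ξ hξ] at hd
  refine hd.of_local_left_inverse hc (mul_pos hξ.1 (H.X_pos _ (hτ.mem ξ hξ))).ne' ?_
  filter_upwards [Ioo_mem_nhds hξ.1 hξ.2] with s hs using hτ.right_inv s hs

theorem tendsto_zero (H : RadialOrbit m σ α β l ξ₀ a X Y Z r φ) (hτ : IsRadialInverse ξ₀ a r τ) :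
    Tendsto τ (𝓝[>] 0) (𝓝[>] a) := by
  have hξ₀ : 0 < ξ₀ := (hτ.r_mem (a + 1) (lt_add_one a)).1.trans (hτ.r_mem _ (lt_add_one a)).2
  refine tendsto_nhdsWithin_iff.mpr ⟨?_, ?_⟩
  · refine tendsto_order.mpr ⟨fun c hc => ?_, fun c hc => ?_⟩
    · filter_upwards [Ioo_mem_nhdsGT hξ₀] with ξ hξ using hc.trans (hτ.mem ξ hξ)
    · filter_upwards [Ioo_mem_nhdsGT (hτ.r_mem c hc).1] with ξ hξ
      have := hτ.strictMonoOn H ⟨hξ.1, hξ.2.trans (hτ.r_mem c hc).2⟩ (hτ.r_mem c hc) hξ.2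
      rwa [hτ.left_inv c hc] at this
  · filter_upwards [Ioo_mem_nhdsGT hξ₀] with ξ hξ using hτ.mem ξ hξ

theorem tendsto_atTop (H : RadialOrbit m σ α β l ξ₀ a X Y Z r φ) (hτ : IsRadialInverse ξ₀ a r τ) :
    Tendsto τ (𝓝[<] ξ₀) atTop := by
  refine Filter.tendsto_atTop.mpr fun c => ?_
  have hc : max c (a + 1) ∈ Ioi a := (lt_add_one a).trans_le (le_max_right _ _)
  have hm := hτ.r_mem _ hc
  filter_upwards [Ioo_mem_nhdsLT hm.2] with ξ hξ
  have := hτ.strictMonoOn H hm ⟨hm.1.trans hξ.1, hξ.2⟩ hξ.1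
  rw [hτ.left_inv _ hc] at this
  exact (le_max_left _ _).trans this.le

end IsRadialInverse

end Inverse

/-- A compactly supported profile `f` with interface at `ξ₀`, in terms of `y` such that
`(f^m)' = α ξ f y`. -/
structure CompactProfile (m σ α β ξ₀ : ℝ) (f y : ℝ → ℝ) : Prop where
  ξ₀_pos : 0 < ξ₀
  continuousOn : ContinuousOn f (Ici 0)
  pos : ∀ ξ ∈ Ico 0 ξ₀, 0 < f ξ
  eq_zero : ∀ ξ, ξ₀ ≤ ξ → f ξ = 0
  y_neg : ∀ ξ ∈ Ioo 0 ξ₀, y ξ < 0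
  continuousOn_y : ContinuousOn y (Ioi 0)
  hasDerivAt : ∀ ξ ∈ Ioi 0, HasDerivAt f (α / m * ξ * f ξ ^ (2 - m) * y ξ) ξ
  hasDerivAt_flux : ∀ ξ ∈ Ioi 0, HasDerivAt (fun ξ => α * ξ * f ξ * y ξ)
    (α * f ξ - β * ξ * (α / m * ξ * f ξ ^ (2 - m) * y ξ) - ξ ^ σ * f ξ ^ (2 - m)) ξ
  tendsto_mul_y : ∃ L, Tendsto (fun ξ => ξ * y ξ) (𝓝[>] 0) (𝓝 L)

theorem rpow_two_sub {x : ℝ} (hx : 0 < x) (m : ℝ) : x ^ (2 - m) = x / x ^ (m - 1) := by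
  rw [show 2 - m = 1 - (m - 1) by ring, Real.rpow_sub hx, Real.rpow_one]

theorem continuousAt_ite_lt {g : ℝ → ℝ} {x c : ℝ} (h : Tendsto g (𝓝[<] x) (𝓝 c)) :
    ContinuousAt (fun t => if t < x then g t else c) x := by
  rw [continuousAt_iff_continuous_left'_right']
  constructor <;> simp only [ContinuousWithinAt, lt_irrefl, if_false]
  · refine h.congr' ?_
    filter_upwards [self_mem_nhdsWithin] with t ht using (if_pos ht).symm
  · refine tendsto_const_nhds.congr' ?_
    filter_upwards [self_mem_nhdsWithin] with t ht using (if_neg (not_lt.mpr (le_of_lt ht))).symm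

/-! ### The profile built from the orbit and extended by zero. -/

section Construction

variable {m σ α β l ξ₀ a : ℝ} {X Y Z r φ : ℝ → ℝ}

theorem RadialOrbit.exists_compactProfile (hm : 1 < m) (hm2 : m < 2) (hα : 0 < α) (hβ : 0 < β)
    (H : RadialOrbit m σ α β l ξ₀ a X Y Z r φ) {τ : ℝ → ℝ} (hτ : IsRadialInverse ξ₀ a r τ) :
    ∃ f y, CompactProfile m σ α β ξ₀ f y ∧
      ∀ ξ ∈ Ioo 0 ξ₀, f ξ = φ (τ ξ) ∧ y ξ = Y (τ ξ) := by
  obtain ⟨A, hA, hφA⟩ := H.exists_tendsto_φ hm hα hβ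
  obtain ⟨y₀, hy₀⟩ := H.exists_tendsto_r_mul_Y hm hα hβ
  have hξ₀ : 0 < ξ₀ := (hτ.r_mem (a + 1) (lt_add_one a)).1.trans (hτ.r_mem _ (lt_add_one a)).2
  have hm0 : 0 < m := by linarith
  have h2m : 0 < 2 - m := by linarith
  -- The value A makes f continuous at the origin. Beyond ξ₀ the factor y only multiplies f = 0, and
  -- the value λ keeps y continuous there.
  set f : ℝ → ℝ := fun ξ => if ξ ≤ 0 then A else if ξ < ξ₀ then φ (τ ξ) else 0 with hf
  set y : ℝ → ℝ := fun ξ => if ξ < ξ₀ then Y (τ ξ) else l with hy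
  have hfin : ∀ ξ ∈ Ioo 0 ξ₀, f ξ = φ (τ ξ) := fun ξ hξ => by
    simp only [hf]; rw [if_neg (not_le.mpr hξ.1), if_pos hξ.2]
  have hyin : ∀ ξ ∈ Ioo 0 ξ₀, y ξ = Y (τ ξ) := fun ξ hξ => by
    simp only [hy]; rw [if_pos hξ.2]
  have hfout : ∀ ξ, ξ₀ ≤ ξ → f ξ = 0 := fun ξ hξ => by
    simp only [hf]; rw [if_neg (not_le.mpr (hξ₀.trans_le hξ)), if_neg (not_lt.mpr hξ)]
  have hyout : ∀ ξ, ξ₀ ≤ ξ → y ξ = l := fun ξ hξ => by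
    simp only [hy]; rw [if_neg (not_lt.mpr hξ)]
  have hev : ∀ ξ ∈ Ioo 0 ξ₀, Ioo 0 ξ₀ ∈ 𝓝 ξ := fun ξ hξ => Ioo_mem_nhds hξ.1 hξ.2
  have hfev : ∀ ξ ∈ Ioo 0 ξ₀, f =ᶠ[𝓝 ξ] fun s => φ (τ s) := fun ξ hξ =>
    mem_of_superset (hev ξ hξ) hfin
  have hyev : ∀ ξ ∈ Ioo 0 ξ₀, y =ᶠ[𝓝 ξ] fun s => Y (τ s) := fun ξ hξ =>
    mem_of_superset (hev ξ hξ) hyin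
  have hfev' : ∀ ξ, ξ₀ < ξ → f =ᶠ[𝓝 ξ] fun _ => 0 := fun ξ hξ =>
    mem_of_superset (Ioi_mem_nhds hξ) (fun s hs => hfout s (le_of_lt hs))
  have hyev' : ∀ ξ, ξ₀ < ξ → y =ᶠ[𝓝 ξ] fun _ => l := fun ξ hξ =>
    mem_of_superset (Ioi_mem_nhds hξ) (fun s hs => hyout s (le_of_lt hs))
  have hfd : ∀ ξ ∈ Ioo 0 ξ₀, HasDerivAt f (α / m * ξ * f ξ ^ (2 - m) * y ξ) ξ := by
    intro ξ hξ
    have hη := hτ.mem ξ hξ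
    have hφ := H.φ_pos _ hη
    have hX := H.X_eq _ hη
    rw [hτ.right_inv ξ hξ] at hX
    refine (((H.hasDerivAt_φ _ hη).comp ξ (hτ.hasDerivAt H ξ hξ)).congr_of_eventuallyEq
      (hfev ξ hξ)).congr_deriv ?_
    rw [hfin ξ hξ, hyin ξ hξ, hX, rpow_two_sub hφ]
    have := hξ.1.ne'
    have := (Real.rpow_pos_of_pos hφ (m - 1)).ne'
    generalize φ (τ ξ) ^ (m - 1) = P at *
    field_simp
  have hgd : ∀ ξ ∈ Ioo 0 ξ₀, HasDerivAt (fun ξ => α * ξ * f ξ * y ξ)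
      (α * f ξ - β * ξ * (α / m * ξ * f ξ ^ (2 - m) * y ξ) - ξ ^ σ * f ξ ^ (2 - m)) ξ := by
    intro ξ hξ
    have hη := hτ.mem ξ hξ
    have hφ := H.φ_pos _ hη
    have hX := H.X_eq _ hη
    have hZ := H.Z_eq _ hη
    rw [hτ.right_inv ξ hξ] at hX hZ
    have hyd : HasDerivAt y _ ξ := ((H.hasDerivAt_Y _ hη).comp ξ
      (hτ.hasDerivAt H ξ hξ)).congr_of_eventuallyEq (hyev ξ hξ)
    refine ((((hasDerivAt_id ξ).const_mul α).mul (hfd ξ hξ)).mul hyd).congr_deriv ?_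
    have e : ξ ^ σ = ξ ^ (σ - 2) * ξ ^ 2 := by
      rw [← Real.rpow_natCast ξ 2, ← Real.rpow_add hξ.1]; norm_num
    simp only [Pi.mul_apply, id]
    rw [hfin ξ hξ, hyin ξ hξ, hX, hZ, e, rpow_two_sub hφ]
    have := hξ.1.ne'
    have := (Real.rpow_pos_of_pos hφ (m - 1)).ne'
    generalize φ (τ ξ) ^ (m - 1) = P at *
    generalize ξ ^ (σ - 2) = Q at *
    field_simp
    ring
  have hfc₀ : ContinuousAt f ξ₀ := by
    have h1 : ContinuousAt (fun ξ => if ξ < ξ₀ then φ (τ ξ) else 0) ξ₀ :=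
      continuousAt_ite_lt (H.tendsto_φ.comp (hτ.tendsto_atTop H))
    refine h1.congr ?_
    filter_upwards [Ioi_mem_nhds hξ₀] with s hs
    simp only [hf]
    rw [if_neg (not_le.mpr hs)]
  have hyc₀ : ContinuousAt y ξ₀ :=
    continuousAt_ite_lt (H.tendsto_Y.comp (hτ.tendsto_atTop H))
  have hyc : ∀ ξ ∈ Ioi (0 : ℝ), ContinuousAt y ξ := by
    intro ξ hξ
    rcases lt_trichotomy ξ ξ₀ with h | h | h
    · exact ((H.hasDerivAt_Y _ (hτ.mem ξ ⟨hξ, h⟩)).comp ξ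
        (hτ.hasDerivAt H ξ ⟨hξ, h⟩)).continuousAt.congr (hyev ξ ⟨hξ, h⟩).symm
    · exact h ▸ hyc₀
    · exact continuousAt_const.congr (hyev' ξ h).symm
  have hfd' : ∀ ξ ∈ Ioi (0 : ℝ), ξ ≠ ξ₀ →
      HasDerivAt f (α / m * ξ * f ξ ^ (2 - m) * y ξ) ξ := by
    intro ξ hξ hne
    rcases lt_or_gt_of_ne hne with h | h
    · exact hfd ξ ⟨hξ, h⟩
    · refine ((hasDerivAt_const ξ (0 : ℝ)).congr_of_eventuallyEq (hfev' ξ h)).congr_deriv ?_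
      rw [hfout ξ h.le, Real.zero_rpow h2m.ne']; ring
  have hgd' : ∀ ξ ∈ Ioi (0 : ℝ), ξ ≠ ξ₀ → HasDerivAt (fun ξ => α * ξ * f ξ * y ξ)
      (α * f ξ - β * ξ * (α / m * ξ * f ξ ^ (2 - m) * y ξ) - ξ ^ σ * f ξ ^ (2 - m)) ξ := by
    intro ξ hξ hne
    rcases lt_or_gt_of_ne hne with h | h
    · exact hgd ξ ⟨hξ, h⟩
    · refine ((hasDerivAt_const ξ (0 : ℝ)).congr_of_eventuallyEq ?_).congr_deriv ?_
      · filter_upwards [hfev' ξ h] with s hs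
        rw [hs]; ring
      · rw [hfout ξ h.le, Real.zero_rpow h2m.ne']; ring
  -- Since 2 - m > 0 and y is continuous at ξ₀, the formulas for both derivatives are continuous
  -- across the interface, so the equation holds there too.
  have hpc : ContinuousAt (fun ξ => f ξ ^ (2 - m)) ξ₀ := hfc₀.rpow_const (Or.inr h2m.le)
  have hid : ContinuousAt (fun ξ : ℝ => ξ) ξ₀ := continuousAt_id
  have hDc : ContinuousAt (fun ξ => α / m * ξ * f ξ ^ (2 - m) * y ξ) ξ₀ :=
    ((hid.const_mul _).mul hpc).mul hyc₀
  have hd : ∀ ξ ∈ Ioi (0 : ℝ), HasDerivAt f (α / m * ξ * f ξ ^ (2 - m) * y ξ) ξ := by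
    intro ξ hξ
    rcases eq_or_ne ξ ξ₀ with rfl | hne
    · exact hasDerivAt_of_eventually_of_ne (mem_of_superset (Ioi_mem_nhds hξ) hfd') hfc₀ hDc
    · exact hfd' ξ hξ hne
  refine ⟨f, y, ⟨hξ₀, ?_, ?_, hfout, ?_, fun ξ hξ => (hyc ξ hξ).continuousWithinAt, hd, ?_, ?_⟩,
    fun ξ hξ => ⟨hfin ξ hξ, hyin ξ hξ⟩⟩
  · intro ξ hξ
    rcases eq_or_lt_of_le (show (0 : ℝ) ≤ ξ from hξ) with h | h
    · subst h
      rw [continuousWithinAt_Ioi_iff_Ici.symm, ContinuousWithinAt]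
      have : f 0 = A := by simp [hf]
      rw [this]
      refine (hφA.comp (hτ.tendsto_zero H)).congr' ?_
      filter_upwards [Ioo_mem_nhdsGT hξ₀] with s hs using (hfin s hs).symm
    · exact (hd ξ h).continuousAt.continuousWithinAt
  · intro ξ hξ
    rcases eq_or_lt_of_le hξ.1 with h | h
    · subst h
      simpa [hf] using hA
    · rw [hfin ξ ⟨h, hξ.2⟩]
      exact H.φ_pos _ (hτ.mem ξ ⟨h, hξ.2⟩)
  · intro ξ hξ
    rw [hyin ξ hξ]
    exact H.Y_neg _ (hτ.mem ξ hξ)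
  · intro ξ hξ
    rcases eq_or_ne ξ ξ₀ with h | hne
    · subst h
      refine hasDerivAt_of_eventually_of_ne (g := fun ξ => α * f ξ -
        β * ξ * (α / m * ξ * f ξ ^ (2 - m) * y ξ) - ξ ^ σ * f ξ ^ (2 - m))
        (mem_of_superset (Ioi_mem_nhds hξ) hgd') (((hid.const_mul _).mul hfc₀).mul hyc₀) ?_
      exact ((hfc₀.const_mul _).sub ((hid.const_mul _).mul hDc)).sub
        ((hid.rpow_const (Or.inl hξ₀.ne')).mul hpc)
    · exact hgd' ξ hξ hne
  · refine ⟨y₀, (hy₀.comp (hτ.tendsto_zero H)).congr' ?_⟩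
    filter_upwards [Ioo_mem_nhdsGT hξ₀] with s hs
    rw [Function.comp_apply, hτ.right_inv s hs, hyin s hs]

end Construction

theorem tendsto_nhdsGT_of_continuousOn {f : ℝ → ℝ} (hf : ContinuousOn f (Ici 0)) :
    Tendsto f (𝓝[>] 0) (𝓝 (f 0)) :=
  (hf 0 self_mem_Ici).tendsto.mono_left (nhdsWithin_mono _ Ioi_subset_Ici_self)

/-! ### Regularity and monotonicity of the profile, and its slope at the origin. -/

section Compact

variable {m σ α β ξ₀ : ℝ} {f y : ℝ → ℝ}

namespace CompactProfile

theorem nonneg (C : CompactProfile m σ α β ξ₀ f y) : ∀ ξ, 0 ≤ ξ → 0 ≤ f ξ := fun ξ hξ => by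
  rcases lt_or_ge ξ ξ₀ with h | h
  · exact (C.pos ξ ⟨hξ, h⟩).le
  · exact (C.eq_zero ξ h).ge

theorem hasDerivAt_rpow (hm : 1 < m) (C : CompactProfile m σ α β ξ₀ f y) :
    ∀ ξ ∈ Ioi 0, HasDerivAt (fun s => f s ^ m) (α * ξ * f ξ * y ξ) ξ := by
  intro ξ hξ
  refine ((C.hasDerivAt ξ hξ).rpow_const (p := m) (Or.inr hm.le)).congr_deriv ?_
  have hm0 : m ≠ 0 := by linarith
  -- At a zero of f both sides vanish, because m - 1 > 0.
  rcases (C.nonneg ξ (le_of_lt hξ)).eq_or_lt with h | h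
  · rw [← h, Real.zero_rpow (x := m - 1) (by linarith)]; ring
  · rw [rpow_two_sub h]
    have := (Real.rpow_pos_of_pos h (m - 1)).ne'
    generalize f ξ ^ (m - 1) = P at *
    field_simp

theorem deriv_eq (C : CompactProfile m σ α β ξ₀ f y) :
    ∀ ξ ∈ Ioi 0, deriv f ξ = α / m * ξ * f ξ ^ (2 - m) * y ξ :=
  fun ξ hξ => (C.hasDerivAt ξ hξ).deriv

theorem hasDerivAt_deriv_rpow (hm : 1 < m) (C : CompactProfile m σ α β ξ₀ f y) :
    ∀ ξ ∈ Ioi 0, HasDerivAt (deriv fun s => f s ^ m)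
      (α * f ξ - β * ξ * deriv f ξ - ξ ^ σ * f ξ ^ (2 - m)) ξ := by
  intro ξ hξ
  rw [C.deriv_eq ξ hξ]
  refine (C.hasDerivAt_flux ξ hξ).congr_of_eventuallyEq ?_
  filter_upwards [Ioi_mem_nhds hξ] with s hs using (C.hasDerivAt_rpow hm s hs).deriv

theorem isProfile (hm : 1 < m) (C : CompactProfile m σ (ssAlpha m σ) (ssBeta σ) ξ₀ f y) :
    IsProfile m σ f := by
  refine ⟨C.continuousOn, C.nonneg, fun ξ hξ => (C.hasDerivAt ξ hξ).differentiableAt,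
    fun ξ hξ => (C.hasDerivAt_deriv_rpow hm ξ hξ).differentiableAt, fun ξ hξ => ?_⟩
  rw [(C.hasDerivAt_deriv_rpow hm ξ hξ).deriv]
  ring

theorem continuousOn_deriv (hm2 : m < 2) (C : CompactProfile m σ α β ξ₀ f y) :
    ContinuousOn (deriv f) (Ioi 0) := by
  have hf : ContinuousOn f (Ioi 0) := C.continuousOn.mono Ioi_subset_Ici_self
  refine ContinuousOn.congr (((continuousOn_id.const_mul _).mul
    (hf.rpow_const fun _ _ => Or.inr (by linarith))).mul C.continuousOn_y) C.deriv_eq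

theorem deriv_nonpos (hm : 1 < m) (hm2 : m < 2) (hα : 0 < α)
    (C : CompactProfile m σ α β ξ₀ f y) : ∀ ξ ∈ Ioi 0, deriv f ξ ≤ 0 := by
  intro ξ hξ
  rw [C.deriv_eq ξ hξ]
  rcases lt_or_ge ξ ξ₀ with h | h
  · refine mul_nonpos_of_nonneg_of_nonpos (mul_nonneg (mul_nonneg (by positivity) (le_of_lt hξ))
      (Real.rpow_nonneg (C.nonneg ξ (le_of_lt hξ)) _)) (C.y_neg ξ ⟨hξ, h⟩).le
  · rw [C.eq_zero ξ h, Real.zero_rpow (by linarith)]; simp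

theorem antitoneOn (hm : 1 < m) (hm2 : m < 2) (hα : 0 < α)
    (C : CompactProfile m σ α β ξ₀ f y) : AntitoneOn f (Ici 0) := by
  refine antitoneOn_of_deriv_nonpos (convex_Ici 0) C.continuousOn ?_ ?_ <;> rw [interior_Ici]
  · exact fun ξ hξ => (C.hasDerivAt ξ hξ).differentiableAt.differentiableWithinAt
  · exact C.deriv_nonpos hm hm2 hα

/-- The slope of the profile at the origin is strictly negative: if it vanished, the equation
would give `(f^m)'' (0) = α f(0) > 0` and `f` would increase. -/
theorem exists_tendsto_deriv (hm : 1 < m) (hσ : 2 < σ) (hα : 0 < α)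
    (C : CompactProfile m σ α β ξ₀ f y) :
    ∃ s < 0, Tendsto (deriv f) (𝓝[>] 0) (𝓝 s) := by
  obtain ⟨L, hL⟩ := C.tendsto_mul_y
  have hξ₀ := C.ξ₀_pos
  have hf0 : 0 < f 0 := C.pos 0 ⟨le_rfl, hξ₀⟩
  have hf := tendsto_nhdsGT_of_continuousOn C.continuousOn
  have hfp := hf.rpow_const (p := 2 - m) (Or.inl hf0.ne')
  have hm0 : 0 < m := by linarith
  have hid : Tendsto (fun ξ : ℝ => ξ) (𝓝[>] 0) (𝓝 0) := nhdsWithin_le_nhds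
  have hD : Tendsto (fun ξ => α / m * ξ * f ξ ^ (2 - m) * y ξ) (𝓝[>] 0)
      (𝓝 (α / m * f 0 ^ (2 - m) * L)) := by
    refine ((hfp.const_mul (α / m)).mul hL).congr fun ξ => ?_
    ring
  have hfl : Tendsto (fun ξ => α * ξ * f ξ * y ξ) (𝓝[>] 0) (𝓝 (α * f 0 * L)) := by
    refine ((hf.const_mul α).mul hL).congr fun ξ => ?_
    ring
  refine ⟨_, ?_, hD.congr' (mem_of_superset self_mem_nhdsWithin
    fun ξ hξ => (C.deriv_eq ξ hξ).symm)⟩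
  have hLle : L ≤ 0 := by
    refine le_of_tendsto hL ?_
    filter_upwards [Ioo_mem_nhdsGT hξ₀] with ξ hξ
    exact mul_nonpos_of_nonneg_of_nonpos hξ.1.le (C.y_neg ξ hξ).le
  have hc : 0 < α / m * f 0 ^ (2 - m) := by positivity
  refine mul_neg_of_pos_of_neg hc (lt_of_le_of_ne hLle fun hL0 => ?_)
  subst hL0
  have hE : Tendsto (fun ξ => α * f ξ - β * ξ * (α / m * ξ * f ξ ^ (2 - m) * y ξ) -
      ξ ^ σ * f ξ ^ (2 - m)) (𝓝[>] 0) (𝓝 (α * f 0)) := by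
    have := ((hf.const_mul α).sub ((hid.const_mul β).mul hD)).sub
      ((hid.rpow_const (p := σ) (Or.inr (by linarith))).mul hfp)
    rw [Real.zero_rpow (by linarith)] at this
    simpa using this
  have hev := (hE.eventually_const_lt (mul_pos hα hf0)).and (Ioo_mem_nhdsGT hξ₀)
  obtain ⟨δ, hδ, hsub⟩ := mem_nhdsGT_iff_exists_Ioo_subset.mp hev
  have hδ0 : (0 : ℝ) < δ := hδ
  have hmono := strictMonoOn_of_hasDerivAt_pos (S := Ioo 0 δ) ordConnected_Ioo
    (fun ξ hξ => C.hasDerivAt_flux ξ hξ.1) (fun ξ hξ => (hsub hξ).1)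
  have h1 : δ / 2 ∈ Ioo 0 δ := ⟨by linarith, by linarith⟩
  -- The flux increases from the limit 0, whereas y < 0 forces it to be negative.
  have h2 : 0 ≤ α * (δ / 2) * f (δ / 2) * y (δ / 2) := by
    have : Tendsto (fun ξ => α * ξ * f ξ * y ξ) (𝓝[>] 0) (𝓝 0) := by simpa using hfl
    refine le_of_tendsto this ?_
    filter_upwards [Ioo_mem_nhdsGT h1.1] with ξ hξ
    exact hmono.monotoneOn ⟨hξ.1, hξ.2.trans h1.2⟩ h1 hξ.2.le
  have h3 := (hsub h1).2
  have h4 := C.pos _ ⟨h3.1.le, h3.2⟩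
  have h5 := C.y_neg _ h3
  have : 0 < α * (δ / 2) * f (δ / 2) := by positivity
  linarith [mul_neg_of_pos_of_neg this h5]

end CompactProfile

end Compact

open MeasureTheory

/-! ### Integration by parts for functions of |x|. -/

section ByParts

theorem ContinuousOn.comp_abs {v : ℝ → ℝ} (hv : ContinuousOn v (Ici 0)) :
    Continuous fun x => v |x| :=
  hv.comp_continuous continuous_abs fun x => abs_nonneg x

theorem eventually_atTop_eq_zero {ψ : ℝ → ℝ} (hc : HasCompactSupport ψ) :
    ∀ᶠ x in atTop, ψ x = 0 := by
  have := hasCompactSupport_iff_eventuallyEq.mp hc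
  rw [coclosedCompact_eq_cocompact] at this
  exact atTop_le_cocompact this

theorem iteratedDeriv_two_eq (ψ : ℝ → ℝ) : iteratedDeriv 2 ψ = deriv (deriv ψ) := by
  rw [iteratedDeriv_succ, iteratedDeriv_one]

variable {v D E : ℝ → ℝ}

theorem integrable_abs_by_parts (hv : ContinuousOn v (Ici 0)) (hE : ContinuousOn E (Ici 0))
    {ψ : ℝ → ℝ} (hψ : ContDiff ℝ 2 ψ) (hc : HasCompactSupport ψ) :
    Integrable fun x => v |x| * iteratedDeriv 2 ψ x - E |x| * ψ x := by
  have h2 : Continuous (iteratedDeriv 2 ψ) := hψ.continuous_iteratedDeriv 2 le_rfl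
  have hc2 : HasCompactSupport (iteratedDeriv 2 ψ) := by
    rw [iteratedDeriv_two_eq]; exact hc.deriv.deriv
  exact (((ContinuousOn.comp_abs hv).mul h2).integrable_of_hasCompactSupport hc2.mul_left).sub
    (((ContinuousOn.comp_abs hE).mul hψ.continuous).integrable_of_hasCompactSupport hc.mul_left)

/-- Twofold integration by parts on a half-line. -/
theorem integral_Ioi_by_parts (hv : ContinuousOn v (Ici 0)) (hD : ContinuousOn D (Ici 0))
    (hE : ContinuousOn E (Ici 0)) (hvD : ∀ x ∈ Ioi 0, HasDerivAt v (D x) x)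
    (hDE : ∀ x ∈ Ioi 0, HasDerivAt D (E x) x) {ψ : ℝ → ℝ} (hψ : ContDiff ℝ 2 ψ)
    (hc : HasCompactSupport ψ) :
    ∫ x in Ioi 0, (v |x| * iteratedDeriv 2 ψ x - E |x| * ψ x) =
      D 0 * ψ 0 - v 0 * deriv ψ 0 := by
  have hd0 : ∀ x, HasDerivAt ψ (deriv ψ x) x := fun x =>
    (hψ.differentiable (by norm_num) x).hasDerivAt
  have hψ1 : ContDiff ℝ 1 (deriv ψ) := by
    have : ContDiff ℝ (1 + 1) ψ := by rw [one_add_one_eq_two]; exact hψ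
    exact (contDiff_succ_iff_deriv.mp this).2.2
  have hd1 : ∀ x, HasDerivAt (deriv ψ) (iteratedDeriv 2 ψ x) x := fun x => by
    rw [iteratedDeriv_two_eq]
    exact (hψ1.differentiable (by norm_num) x).hasDerivAt
  -- The integrand has primitive vψ' - Dψ, which the compact support kills at infinity.
  have h := integral_Ioi_of_hasDerivAt_of_tendsto (a := 0) (m := (0 : ℝ))
    (f := fun x => v x * deriv ψ x - D x * ψ x)
    (f' := fun x => v |x| * iteratedDeriv 2 ψ x - E |x| * ψ x) ?_ ?_
    (integrable_abs_by_parts hv hE hψ hc).integrableOn ?_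
  · rw [h]; ring
  · exact ((hv 0 self_mem_Ici).mul hψ1.continuous.continuousWithinAt).sub
      ((hD 0 self_mem_Ici).mul hψ.continuous.continuousWithinAt)
  · intro x hx
    refine (((hvD x hx).mul (hd1 x)).sub ((hDE x hx).mul (hd0 x))).congr_deriv ?_
    rw [abs_of_pos hx]
    ring
  · refine tendsto_const_nhds.congr' ?_
    filter_upwards [eventually_atTop_eq_zero hc, eventually_atTop_eq_zero hc.deriv] with x h1 h2
    rw [h1, h2]; ring

/-- Integration by parts against an even function with a corner at the origin. -/
theorem integral_abs_by_parts (hv : ContinuousOn v (Ici 0)) (hD : ContinuousOn D (Ici 0))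
    (hE : ContinuousOn E (Ici 0)) (hvD : ∀ x ∈ Ioi 0, HasDerivAt v (D x) x)
    (hDE : ∀ x ∈ Ioi 0, HasDerivAt D (E x) x) {ψ : ℝ → ℝ} (hψ : ContDiff ℝ 2 ψ)
    (hc : HasCompactSupport ψ) :
    ∫ x, (v |x| * iteratedDeriv 2 ψ x - E |x| * ψ x) = 2 * D 0 * ψ 0 := by
  have hi := integrable_abs_by_parts hv hE hψ hc
  -- The left half-line is the right one for the reflected ψ: the terms in v(0)ψ'(0) cancel and
  -- those in D(0)ψ(0) add up.
  have hψn : ContDiff ℝ 2 fun x => ψ (-x) := hψ.comp contDiff_neg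
  have hcn : HasCompactSupport fun x => ψ (-x) :=
    hc.comp_homeomorph (Homeomorph.neg ℝ)
  have h1 := integral_Ioi_by_parts hv hD hE hvD hDE hψ hc
  have h2 := integral_Ioi_by_parts hv hD hE hvD hDE hψn hcn
  have h3 := integral_comp_neg_Ioi 0 fun x => v |x| * iteratedDeriv 2 ψ x - E |x| * ψ x
  rw [neg_zero] at h3
  rw [← intervalIntegral.integral_Iic_add_Ioi hi.integrableOn hi.integrableOn (b := 0), h1, ← h3]
  have h4 : ∫ x in Ioi (0 : ℝ), (v |-x| * iteratedDeriv 2 ψ (-x) - E |-x| * ψ (-x)) =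
      D 0 * ψ (-0) - v 0 * deriv (fun x => ψ (-x)) 0 := by
    rw [← h2]
    congr 1
    funext x
    rw [abs_neg, iteratedDeriv_comp_neg]
    norm_num
  rw [h4, deriv_comp_neg, neg_zero]
  ring

end ByParts

/-! ### Partial derivatives and slices of test functions. -/

section TestFunctions

variable {φ : ℝ × ℝ → ℝ}

theorem deriv_snd_eq (hφ : ContDiff ℝ ∞ φ) (z : ℝ × ℝ) :
    deriv (fun t => φ (z.1, t)) z.2 = fderiv ℝ φ z (0, 1) := by
  have h := (hφ.differentiable (by norm_num) z).hasFDerivAt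
  have h2 : HasDerivAt (fun t : ℝ => (z.1, t)) ((0 : ℝ), (1 : ℝ)) z.2 :=
    (hasDerivAt_const z.2 z.1).prodMk (hasDerivAt_id z.2)
  exact (HasFDerivAt.comp_hasDerivAt z.2 (f := fun t : ℝ => (z.1, t)) (l := φ) h h2).deriv

theorem deriv_fst_eq (hφ : ContDiff ℝ ∞ φ) (z : ℝ × ℝ) :
    deriv (fun x => φ (x, z.2)) z.1 = fderiv ℝ φ z (1, 0) := by
  have h := (hφ.differentiable (by norm_num) z).hasFDerivAt
  have h2 : HasDerivAt (fun x : ℝ => (x, z.2)) ((1 : ℝ), (0 : ℝ)) z.1 :=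
    (hasDerivAt_id z.1).prodMk (hasDerivAt_const z.1 z.2)
  exact (HasFDerivAt.comp_hasDerivAt z.1 (f := fun x : ℝ => (x, z.2)) (l := φ) h h2).deriv

theorem contDiff_fderiv_apply (hφ : ContDiff ℝ ∞ φ) (e : ℝ × ℝ) :
    ContDiff ℝ ∞ fun z => fderiv ℝ φ z e :=
  (hφ.fderiv_right (m := ∞) le_rfl).clm_apply contDiff_const

theorem iteratedDeriv_two_fst_eq (hφ : ContDiff ℝ ∞ φ) (z : ℝ × ℝ) :
    iteratedDeriv 2 (fun x => φ (x, z.2)) z.1 =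
      fderiv ℝ (fun w => fderiv ℝ φ w (1, 0)) z (1, 0) := by
  rw [iteratedDeriv_two_eq, ← deriv_fst_eq (contDiff_fderiv_apply hφ (1, 0)) z]
  congr 1
  funext x
  exact deriv_fst_eq hφ (x, z.2)

variable {W : Set (ℝ × ℝ)} {w ψ : ℝ × ℝ → ℝ}

/-- Lets functions that are continuous only on the strip enter integrals over the whole plane. -/
theorem continuous_mul_of_tsupport_subset (hW : IsOpen W) (hw : ContinuousOn w W)
    (hψ : Continuous ψ) (hs : tsupport ψ ⊆ W) : Continuous fun z => w z * ψ z := by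
  refine continuous_iff_continuousAt.mpr fun z => ?_
  by_cases hz : z ∈ tsupport ψ
  · exact (hw.continuousAt (hW.mem_nhds (hs hz))).mul hψ.continuousAt
  · refine (continuousAt_const (y := (0 : ℝ))).congr ?_
    filter_upwards [notMem_tsupport_iff_eventuallyEq.mp hz] with s hs
    simp [hs]

theorem hasCompactSupport_slice_fst (hψ : HasCompactSupport ψ) (t : ℝ) :
    HasCompactSupport fun x => ψ (x, t) := by
  refine HasCompactSupport.intro (hψ.isCompact.image continuous_fst) fun x hx => ?_
  by_contra h
  exact hx ⟨(x, t), subset_tsupport _ h, rfl⟩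

theorem hasCompactSupport_slice_snd (hψ : HasCompactSupport ψ) (x : ℝ) :
    HasCompactSupport fun t => ψ (x, t) := by
  refine HasCompactSupport.intro (hψ.isCompact.image continuous_snd) fun t ht => ?_
  by_contra h
  exact ht ⟨(x, t), subset_tsupport _ h, rfl⟩

end TestFunctions

/-- Gives u_t and (u^m)_xx the same power of T - t. -/
theorem ssAlpha_mul {m σ : ℝ} (hm : 1 < m) (hσ : 2 < σ) :
    ssAlpha m σ * (m - 1) = 2 * ssBeta σ + 1 := by
  have h1 : σ - 2 ≠ 0 := by linarith
  have h2 : m - 1 ≠ 0 := by linarith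
  unfold ssAlpha ssBeta
  field_simp
  ring

/-- Gives the reaction term the same power of T - t as u_t. -/
theorem ssBeta_mul {m σ : ℝ} (hm : 1 < m) (hσ : 2 < σ) :
    ssBeta σ * σ = ssAlpha m σ * (m - 1) + 1 := by
  have h1 : σ - 2 ≠ 0 := by linarith
  have h2 : m - 1 ≠ 0 := by linarith
  unfold ssAlpha ssBeta
  field_simp
  ring

/-! ### Continuity up to the origin of the terms of the profile equation. -/

section Profile

variable {m σ s : ℝ} {f : ℝ → ℝ}

theorem continuousOn_Ici_of_tendsto {g : ℝ → ℝ} (hg : ContinuousOn g (Ioi 0))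
    (h0 : Tendsto g (𝓝[>] 0) (𝓝 (g 0))) : ContinuousOn g (Ici 0) := by
  intro x hx
  rcases eq_or_lt_of_le (show (0 : ℝ) ≤ x from hx) with h | h
  · subst h
    exact continuousWithinAt_Ioi_iff_Ici.mp h0
  · exact (hg.continuousAt (Ioi_mem_nhds h)).continuousWithinAt

/-- The factor ξ makes the value of `deriv f` at 0 irrelevant. -/
theorem continuousOn_mul_deriv (hd : ContinuousOn (deriv f) (Ioi 0))
    (h0 : Tendsto (deriv f) (𝓝[>] 0) (𝓝 s)) : ContinuousOn (fun ξ => ξ * deriv f ξ) (Ici 0) := by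
  refine continuousOn_Ici_of_tendsto (continuousOn_id.mul hd) ?_
  have h1 : Tendsto (fun ξ : ℝ => ξ) (𝓝[>] 0) (𝓝 0) := nhdsWithin_le_nhds
  simpa using h1.mul h0

/-- The second derivative of `f^m` prescribed by the profile equation. -/
noncomputable def profileRhs (m σ : ℝ) (f : ℝ → ℝ) (ξ : ℝ) : ℝ :=
  ssAlpha m σ * f ξ - ssBeta σ * (ξ * deriv f ξ) - ξ ^ σ * f ξ ^ (2 - m)

theorem continuousOn_profileRhs (hm2 : m < 2) (hσ : 2 < σ) (hf : ContinuousOn f (Ici 0))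
    (hd : ContinuousOn (deriv f) (Ioi 0)) (h0 : Tendsto (deriv f) (𝓝[>] 0) (𝓝 s)) :
    ContinuousOn (profileRhs m σ f) (Ici 0) :=
  ((hf.const_mul _).sub ((continuousOn_mul_deriv hd h0).const_mul _)).sub
    ((continuousOn_id.rpow_const fun _ _ => Or.inr (by linarith)).mul
      (hf.rpow_const fun _ _ => Or.inr (by linarith)))

/-- The first derivative of `f^m`, extended by continuity to the origin. -/
theorem IsProfile.exists_hasDerivAt_rpow (hm : 1 < m) (hf : IsProfile m σ f)
    (hd : ContinuousOn (deriv f) (Ioi 0)) (h0 : Tendsto (deriv f) (𝓝[>] 0) (𝓝 s)) (hs : s ≤ 0) :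
    ∃ D : ℝ → ℝ, ContinuousOn D (Ici 0) ∧ D 0 ≤ 0 ∧
      (∀ ξ ∈ Ioi 0, HasDerivAt (fun ξ => f ξ ^ m) (D ξ) ξ) ∧
      ∀ ξ ∈ Ioi 0, HasDerivAt D (profileRhs m σ f ξ) ξ := by
  -- The one-sided limit is put in by hand at 0, since `deriv f 0` carries no information.
  set D : ℝ → ℝ := fun ξ => if ξ ≤ 0 then s * m * f 0 ^ (m - 1)
    else deriv f ξ * m * f ξ ^ (m - 1) with hD
  have hDpos : ∀ ξ ∈ Ioi (0 : ℝ), D ξ = deriv f ξ * m * f ξ ^ (m - 1) := fun ξ hξ => by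
    simp only [hD]; rw [if_neg (not_le.mpr hξ)]
  have hD0 : D 0 = s * m * f 0 ^ (m - 1) := by simp [hD]
  have hder : ∀ ξ ∈ Ioi 0, HasDerivAt (fun ξ => f ξ ^ m) (D ξ) ξ := fun ξ hξ => by
    rw [hDpos ξ hξ]
    exact (hf.differentiableAt ξ hξ).hasDerivAt.rpow_const (Or.inr hm.le)
  refine ⟨D, continuousOn_Ici_of_tendsto ?_ ?_, ?_, hder, fun ξ hξ => ?_⟩
  · refine ContinuousOn.congr ((hd.mul continuousOn_const).mul
      ((hf.continuousOn.mono Ioi_subset_Ici_self).rpow_const fun _ _ => Or.inr (by linarith))) hDpos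
  · rw [hD0]
    refine ((h0.mul_const m).mul ((tendsto_nhdsGT_of_continuousOn hf.continuousOn).rpow_const
      (Or.inr (by linarith)))).congr' ?_
    filter_upwards [self_mem_nhdsWithin] with ξ hξ using (hDpos ξ hξ).symm
  · rw [hD0]
    exact mul_nonpos_of_nonpos_of_nonneg (mul_nonpos_of_nonpos_of_nonneg hs (by linarith))
      (Real.rpow_nonneg (hf.nonneg 0 le_rfl) _)
  · refine ((hf.differentiableAt_deriv ξ hξ).hasDerivAt.congr_deriv ?_).congr_of_eventuallyEq ?_
    · have := hf.ode ξ hξ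
      unfold profileRhs
      linarith
    · filter_upwards [Ioi_mem_nhds hξ] with t ht using (hder t ht).deriv.symm

end Profile

/-! ### The weak inequality for the self-similar function. -/

section Supersolution

variable {m p σ s T : ℝ} {f : ℝ → ℝ}

theorem isOpen_strip (T : ℝ) : IsOpen ((univ : Set ℝ) ×ˢ Ioo 0 T) := isOpen_univ.prod isOpen_Ioo

/-- Self-similar rescalings of continuous functions on `[0, ∞)` are continuous on the strip. -/
theorem continuousOn_selfSimilar (k b T : ℝ) {g : ℝ → ℝ} (hg : ContinuousOn g (Ici 0)) :
    ContinuousOn (fun z : ℝ × ℝ => (T - z.2) ^ k * g (|z.1| * (T - z.2) ^ b))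
      (univ ×ˢ Ioo 0 T) := by
  have hpow : ∀ q : ℝ, ContinuousOn (fun z : ℝ × ℝ => (T - z.2) ^ q) (univ ×ˢ Ioo 0 T) := fun q =>
    (continuousOn_const.sub continuousOn_snd).rpow_const
      fun z hz => Or.inl (sub_pos.mpr hz.2.2).ne'
  refine (hpow k).mul (hg.comp ((continuous_fst.abs.continuousOn).mul (hpow b)) fun z hz => ?_)
  exact mul_nonneg (abs_nonneg _) (Real.rpow_nonneg (sub_pos.mpr hz.2.2).le _)

/-- The time derivative of a self-similar function. -/
theorem hasDerivAt_selfSimilar (hf : ∀ ξ, 0 < ξ → DifferentiableAt ℝ f ξ) {x t : ℝ} (hx : x ≠ 0)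
    (ht : t < T) : HasDerivAt (fun t => selfSimilar m σ T f x t)
      ((T - t) ^ (-ssAlpha m σ - 1) * (ssAlpha m σ * f (|x| * (T - t) ^ ssBeta σ) -
        ssBeta σ * (|x| * (T - t) ^ ssBeta σ * deriv f (|x| * (T - t) ^ ssBeta σ)))) t := by
  have hT : 0 < T - t := sub_pos.mpr ht
  have hξ : 0 < |x| * (T - t) ^ ssBeta σ := mul_pos (abs_pos.mpr hx) (Real.rpow_pos_of_pos hT _)
  have h1 : HasDerivAt (fun t => T - t) (-1) t := by
    simpa using (hasDerivAt_id t).const_sub T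
  have h2 := h1.rpow_const (p := -ssAlpha m σ) (Or.inl hT.ne')
  have h3 := (h1.rpow_const (p := ssBeta σ) (Or.inl hT.ne')).const_mul |x|
  have h4 : HasDerivAt (fun t => f (|x| * (T - t) ^ ssBeta σ)) _ t :=
    (hf _ hξ).hasDerivAt.comp t h3
  refine (h2.mul h4).congr_deriv ?_
  rw [Real.rpow_sub_one hT.ne', Real.rpow_sub_one hT.ne']
  field_simp
  ring

/-- The rescaled equation at the points where `x ≠ 0`, without derivatives of `u`. -/
theorem rescaled_equation (hm : 1 < m) (hmp : m + p = 2) (hσ : 2 < σ)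
    (hf : ∀ ξ, 0 ≤ ξ → 0 ≤ f ξ) (x : ℝ) {t : ℝ} (ht : t < T) :
    (T - t) ^ (-ssAlpha m σ - 1) * profileRhs m σ f (|x| * (T - t) ^ ssBeta σ) +
      |x| ^ σ * selfSimilar m σ T f x t ^ p =
    (T - t) ^ (-ssAlpha m σ - 1) * (ssAlpha m σ * f (|x| * (T - t) ^ ssBeta σ) -
        ssBeta σ * (|x| * (T - t) ^ ssBeta σ * deriv f (|x| * (T - t) ^ ssBeta σ))) := by
  have hT : 0 < T - t := sub_pos.mpr ht
  have hξ : 0 ≤ |x| * (T - t) ^ ssBeta σ := mul_nonneg (abs_nonneg x) (Real.rpow_nonneg hT.le _)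
  obtain rfl : p = 2 - m := by linarith
  unfold profileRhs selfSimilar
  rw [Real.mul_rpow (Real.rpow_nonneg hT.le _) (hf _ hξ),
    Real.mul_rpow (abs_nonneg x) (Real.rpow_nonneg hT.le _), ← Real.rpow_mul hT.le,
    ← Real.rpow_mul hT.le]
  have e : (T - t) ^ (-ssAlpha m σ * (2 - m)) =
      (T - t) ^ (-ssAlpha m σ - 1) * (T - t) ^ (ssBeta σ * σ) := by
    rw [← Real.rpow_add hT, ssBeta_mul hm hσ]
    congr 1
    ring
  rw [e]
  ring

/-- The integral of the diffusion term on a time slice. -/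
theorem IsProfile.integral_slice_nonpos (hm : 1 < m) (hm2 : m < 2) (hσ : 2 < σ)
    (hf : IsProfile m σ f) (hd : ContinuousOn (deriv f) (Ioi 0))
    (h0 : Tendsto (deriv f) (𝓝[>] 0) (𝓝 s)) (hs : s ≤ 0) {t : ℝ} (ht : t < T) {ψ : ℝ → ℝ}
    (hψ : ContDiff ℝ 2 ψ) (hc : HasCompactSupport ψ) (hψ0 : ∀ x, 0 ≤ ψ x) :
    ∫ x, (selfSimilar m σ T f x t ^ m * iteratedDeriv 2 ψ x -
      (T - t) ^ (-ssAlpha m σ - 1) * profileRhs m σ f (|x| * (T - t) ^ ssBeta σ) * ψ x) ≤ 0 := by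
  obtain ⟨D, hDc, hD0, hD1, hD2⟩ := hf.exists_hasDerivAt_rpow hm hd h0 hs
  have hT : 0 < T - t := sub_pos.mpr ht
  set c := (T - t) ^ ssBeta σ with hcdef
  set k := (T - t) ^ (-ssAlpha m σ * m) with hk
  have hcpos : 0 < c := Real.rpow_pos_of_pos hT _
  have hkpos : 0 < k := Real.rpow_pos_of_pos hT _
  -- The exponents agree because -αm + 2β = -α - 1.
  have hkc : (T - t) ^ (-ssAlpha m σ - 1) = k * c * c := by
    rw [hk, hcdef, ← Real.rpow_add hT, ← Real.rpow_add hT]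
    congr 1
    have := ssAlpha_mul hm hσ
    linarith
  have hmaps : MapsTo (fun x : ℝ => x * c) (Ici 0) (Ici 0) := fun x hx => mul_nonneg hx hcpos.le
  have hmul : ContinuousOn (fun x : ℝ => x * c) (Ici 0) := continuousOn_id.mul_const c
  have hlin : ∀ x : ℝ, HasDerivAt (fun x => x * c) c x := fun x => by
    simpa using (hasDerivAt_id x).mul_const c
  have key := integral_abs_by_parts (v := fun x => k * f (x * c) ^ m)
    (D := fun x => k * c * D (x * c)) (E := fun x => k * c * c * profileRhs m σ f (x * c))
    (((hf.continuousOn.comp hmul hmaps).rpow_const fun _ _ => Or.inr (by linarith)).const_mul k)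
    ((hDc.comp hmul hmaps).const_mul _)
    (((continuousOn_profileRhs hm2 hσ hf.continuousOn hd h0).comp hmul hmaps).const_mul _)
    (fun x hx => ((HasDerivAt.comp x (h₂ := fun ξ => f ξ ^ m) (hD1 _ (mul_pos hx hcpos))
      (hlin x)).const_mul k).congr_deriv (by ring))
    (fun x hx => (((hD2 _ (mul_pos hx hcpos)).comp x (hlin x)).const_mul (k * c)).congr_deriv
      (by ring)) hψ hc
  have e : ∀ x, selfSimilar m σ T f x t ^ m = k * f (|x| * c) ^ m := fun x => by
    unfold selfSimilar
    rw [Real.mul_rpow (Real.rpow_nonneg hT.le _) (hf.nonneg _ (mul_nonneg (abs_nonneg x) hcpos.le)),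
      ← Real.rpow_mul hT.le]
  simp only [e, hkc]
  rw [key, zero_mul]
  -- Only the corner contributes: 2kc·D(0)ψ(0), with D(0) ≤ 0.
  exact mul_nonpos_of_nonpos_of_nonneg (by
    have := mul_nonpos_of_nonneg_of_nonpos (mul_pos hkpos hcpos).le hD0
    linarith) (hψ0 0)

/-- A profile with nonpositive slope at the origin generates a weak supersolution. -/
theorem IsProfile.isSupersolution (hm : 1 < m) (hm2 : m < 2) (hmp : m + p = 2) (hσ : 2 < σ)
    (hf : IsProfile m σ f) (hd : ContinuousOn (deriv f) (Ioi 0))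
    (h0 : Tendsto (deriv f) (𝓝[>] 0) (𝓝 s)) (hs : s ≤ 0) (T : ℝ) :
    IsSupersolution m p σ T (selfSimilar m σ T f) := by
  have hW := isOpen_strip T
  have hu : ContinuousOn (fun z : ℝ × ℝ => selfSimilar m σ T f z.1 z.2) (univ ×ˢ Ioo 0 T) :=
    continuousOn_selfSimilar _ _ T hf.continuousOn
  refine ⟨hu, fun x t ht => mul_nonneg (Real.rpow_nonneg (sub_pos.mpr ht.2).le _) (hf.nonneg _
    (mul_nonneg (abs_nonneg _) (Real.rpow_nonneg (sub_pos.mpr ht.2).le _))), ?_⟩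
  intro φ hφ hφc hφs hφ0
  set u : ℝ × ℝ → ℝ := fun z => selfSimilar m σ T f z.1 z.2 with hudef
  -- For x ≠ 0 inside the strip, `q` is u_t and `e` represents (u^m)_xx; both formulas stay
  -- continuous at x = 0.
  set q : ℝ × ℝ → ℝ := fun z => (T - z.2) ^ (-ssAlpha m σ - 1) *
    (ssAlpha m σ * f (|z.1| * (T - z.2) ^ ssBeta σ) - ssBeta σ *
      (|z.1| * (T - z.2) ^ ssBeta σ * deriv f (|z.1| * (T - z.2) ^ ssBeta σ))) with hqdef
  set e : ℝ × ℝ → ℝ := fun z => (T - z.2) ^ (-ssAlpha m σ - 1) *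
    profileRhs m σ f (|z.1| * (T - z.2) ^ ssBeta σ) with hedef
  set φt : ℝ × ℝ → ℝ := fun z => fderiv ℝ φ z (0, 1) with hφt
  set φxx : ℝ × ℝ → ℝ := fun z => fderiv ℝ (fun w => fderiv ℝ φ w (1, 0)) z (1, 0) with hφxx
  have hq : ContinuousOn q (univ ×ˢ Ioo 0 T) := continuousOn_selfSimilar _ _ T
    (g := fun ξ => ssAlpha m σ * f ξ - ssBeta σ * (ξ * deriv f ξ))
    ((hf.continuousOn.const_mul _).sub ((continuousOn_mul_deriv hd h0).const_mul _))
  have he : ContinuousOn e (univ ×ˢ Ioo 0 T) := continuousOn_selfSimilar _ _ T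
    (continuousOn_profileRhs hm2 hσ hf.continuousOn hd h0)
  have hum : ContinuousOn (fun z => u z ^ m) (univ ×ˢ Ioo 0 T) :=
    hu.rpow_const fun _ _ => Or.inr (by linarith)
  have hφtc : Continuous φt := (contDiff_fderiv_apply hφ (0, 1)).continuous
  have hφxxc : Continuous φxx :=
    (contDiff_fderiv_apply (contDiff_fderiv_apply hφ (1, 0)) (1, 0)).continuous
  have hφts : tsupport φt ⊆ tsupport φ := tsupport_fderiv_apply_subset ℝ _
  have hφxxs : tsupport φxx ⊆ tsupport φ :=
    (tsupport_fderiv_apply_subset ℝ _).trans (tsupport_fderiv_apply_subset ℝ _)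
  have hφtK : HasCompactSupport φt := hφc.fderiv_apply ℝ _
  have hφxxK : HasCompactSupport φxx := (hφc.fderiv_apply ℝ _).fderiv_apply ℝ _
  have c1 := continuous_mul_of_tsupport_subset hW hu hφtc (hφts.trans hφs)
  have c2 := continuous_mul_of_tsupport_subset hW hq hφ.continuous hφs
  have c3 := continuous_mul_of_tsupport_subset hW hum hφxxc (hφxxs.trans hφs)
  have c4 := continuous_mul_of_tsupport_subset hW he hφ.continuous hφs
  have c5 := continuous_mul_of_tsupport_subset hW hu hφ.continuous hφs
  have k1 : HasCompactSupport fun z => u z * φt z := hφtK.mul_left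
  have k2 : HasCompactSupport fun z => q z * φ z := hφc.mul_left
  have k3 : HasCompactSupport fun z => u z ^ m * φxx z := hφxxK.mul_left
  have k4 : HasCompactSupport fun z => e z * φ z := hφc.mul_left
  have k5 : HasCompactSupport fun z => u z * φ z := hφc.mul_left
  have kt : HasCompactSupport fun z => u z * φt z + q z * φ z := k1.add k2
  have kx : HasCompactSupport fun z => u z ^ m * φxx z - e z * φ z := k3.sub k4
  have it : Integrable fun z => u z * φt z + q z * φ z :=
    (c1.add c2).integrable_of_hasCompactSupport kt
  have ix : Integrable fun z => u z ^ m * φxx z - e z * φ z :=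
    (c3.sub c4).integrable_of_hasCompactSupport kx
  have hzero : ∀ z : ℝ × ℝ, z.2 ∉ Ioo 0 T → z ∉ tsupport φ := fun z hz hz' => hz (hφs hz').2
  -- Since q = e + |x|^σ u^p on the strip, the integrand splits into a time derivative, which
  -- integrates to 0, and the diffusion part, treated slice by slice.
  have hsplit : ∀ z : ℝ × ℝ, u z * deriv (fun t => φ (z.1, t)) z.2
      + u z ^ m * iteratedDeriv 2 (fun x => φ (x, z.2)) z.1
      + |z.1| ^ σ * u z ^ p * φ z =
      (u z * φt z + q z * φ z) + (u z ^ m * φxx z - e z * φ z) := by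
    intro z
    rw [deriv_snd_eq hφ, iteratedDeriv_two_fst_eq hφ]
    by_cases hz : z.2 ∈ Ioo 0 T
    · have h1 : e z + |z.1| ^ σ * u z ^ p = q z :=
        rescaled_equation hm hmp hσ hf.nonneg z.1 hz.2
      rw [← h1]
      ring
    · have : φ z = 0 := image_eq_zero_of_notMem_tsupport (hzero z hz)
      rw [this]
      ring
  have htime : ∫ z, (u z * φt z + q z * φ z) = 0 := by
    rw [Measure.volume_eq_prod, integral_prod _ it]
    refine integral_eq_zero_of_ae ?_
    -- The chain rule needs f differentiable at |x|(T-t)^β, which excludes the null set x = 0.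
    filter_upwards [Measure.ae_ne volume (0 : ℝ)] with x hx
    have hslice : Continuous fun t : ℝ => (x, t) := by fun_prop
    refine integral_eq_zero_of_hasDerivAt_of_integrable (f := fun t => u (x, t) * φ (x, t))
      (fun t => ?_)
      (((c1.add c2).comp hslice).integrable_of_hasCompactSupport (hasCompactSupport_slice_snd kt x))
      ((c5.comp hslice).integrable_of_hasCompactSupport (hasCompactSupport_slice_snd k5 x))
    by_cases ht : t ∈ Ioo 0 T
    · have h1 : HasDerivAt (fun t => u (x, t)) (q (x, t)) t :=
        hasDerivAt_selfSimilar hf.differentiableAt hx ht.2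
      have h2 : HasDerivAt (fun t => φ (x, t)) (φt (x, t)) t := by
        have := deriv_snd_eq hφ (x, t)
        refine HasDerivAt.congr_deriv ?_ this
        exact ((hφ.differentiable (by norm_num)).comp (by fun_prop :
          Differentiable ℝ fun t : ℝ => (x, t)) t).hasDerivAt
      refine (h1.mul h2).congr_deriv ?_
      ring
    · have hz := hzero (x, t) ht
      have h1 : φ (x, t) = 0 := image_eq_zero_of_notMem_tsupport hz
      have h2 : φt (x, t) = 0 := image_eq_zero_of_notMem_tsupport fun h => hz (hφts h)
      rw [h1, h2, mul_zero, mul_zero, add_zero]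
      refine (hasDerivAt_const t (0 : ℝ)).congr_of_eventuallyEq ?_
      filter_upwards [hslice.continuousAt.eventually (notMem_tsupport_iff_eventuallyEq.mp hz)]
        with t' ht'
      simp [ht']
  have hspace : ∫ z, (u z ^ m * φxx z - e z * φ z) ≤ 0 := by
    rw [Measure.volume_eq_prod, integral_prod_symm _ ix]
    refine integral_nonpos fun t => ?_
    by_cases ht : t ∈ Ioo 0 T
    · have hψ : ContDiff ℝ ∞ fun x => φ (x, t) := hφ.comp (by fun_prop)
      have h1 := hf.integral_slice_nonpos hm hm2 hσ hd h0 hs ht.2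
        (contDiff_infty.mp hψ 2) (hasCompactSupport_slice_fst hφc t)
        (fun x => hφ0 (x, t))
      have h2 : ∀ x, iteratedDeriv 2 (fun x => φ (x, t)) x = φxx (x, t) := fun x =>
        iteratedDeriv_two_fst_eq hφ (x, t)
      simp only [h2] at h1
      exact h1
    · refine le_of_eq (integral_eq_zero_of_ae (Eventually.of_forall fun x => ?_))
      have hz := hzero (x, t) ht
      have h1 : φ (x, t) = 0 := image_eq_zero_of_notMem_tsupport hz
      have h2 : φxx (x, t) = 0 := image_eq_zero_of_notMem_tsupport fun h => hz (hφxxs h)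
      simp [h1, h2]
  calc _ = ∫ z, ((u z * φt z + q z * φ z) + (u z ^ m * φxx z - e z * φ z)) :=
        integral_congr_ae (Eventually.of_forall hsplit)
    _ = _ := integral_add it ix
    _ ≤ 0 := by rw [htime, zero_add]; exact hspace

end Supersolution

/-! ### Existence and uniqueness of the profile contained in the orbit. -/

section Contained

variable {m σ α β l ξ₀ a : ℝ} {X Y Z r φ τ f y g : ℝ → ℝ}

theorem CompactProfile.pos_iff (C : CompactProfile m σ α β ξ₀ f y) {ξ : ℝ} (hξ : 0 < ξ) :
    0 < f ξ ↔ ξ < ξ₀ := by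
  refine ⟨fun h => ?_, fun h => C.pos ξ ⟨hξ.le, h⟩⟩
  by_contra hc
  rw [C.eq_zero ξ (not_lt.mp hc)] at h
  exact lt_irrefl _ h

theorem CompactProfile.orbitContains (hm : 1 < m) (hσ : 2 < σ)
    (H : RadialOrbit m σ (ssAlpha m σ) β l ξ₀ a X Y Z r φ) (hτ : IsRadialInverse ξ₀ a r τ)
    (C : CompactProfile m σ (ssAlpha m σ) β ξ₀ f y)
    (hf : ∀ ξ ∈ Ioo 0 ξ₀, f ξ = φ (τ ξ) ∧ y ξ = Y (τ ξ)) :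
    OrbitContains m σ X Y Z (Ioi a) f := by
  have hα := ssAlpha_pos hm hσ
  refine ⟨τ, ?_, fun ξ hξ hfξ => ?_⟩
  · rw [← hτ.image_eq]
    congr 1
    ext ξ
    exact ⟨fun h => ⟨h.1, (C.pos_iff h.1).mp h.2⟩, fun h => ⟨h.1, (C.pos_iff h.1).mpr h.2⟩⟩
  · have hmem : ξ ∈ Ioo 0 ξ₀ := ⟨hξ, (C.pos_iff hξ).mp hfξ⟩
    have hη := hτ.mem ξ hmem
    have hX := H.X_eq _ hη
    have hZ := H.Z_eq _ hη
    rw [hτ.right_inv ξ hmem] at hX hZ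
    rw [← (hf ξ hmem).1] at hX
    have hP := (Real.rpow_pos_of_pos hfξ (m - 1)).ne'
    refine ⟨(hτ.hasDerivAt H ξ hmem).congr_deriv ?_, hX, ?_, hZ⟩
    · rw [hX, show 1 - m = -(m - 1) by ring, Real.rpow_neg hfξ.le]
      generalize f ξ ^ (m - 1) = P at *
      field_simp
    · rw [C.deriv_eq ξ hξ, (hf ξ hmem).2, show m - 2 = -(2 - m) by ring, Real.rpow_neg hfξ.le]
      have hQ := (Real.rpow_pos_of_pos hfξ (2 - m)).ne'
      generalize f ξ ^ (2 - m) = Q at *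
      field_simp

/-- The orbit determines the profile it contains. -/
theorem CompactProfile.eqOn_of_orbitContains (hm : 1 < m) (hσ : 2 < σ)
    (H : RadialOrbit m σ (ssAlpha m σ) β l ξ₀ a X Y Z r φ) (hτ : IsRadialInverse ξ₀ a r τ)
    (C : CompactProfile m σ (ssAlpha m σ) β ξ₀ f y)
    (hf : ∀ ξ ∈ Ioo 0 ξ₀, f ξ = φ (τ ξ) ∧ y ξ = Y (τ ξ))
    (hg : IsProfile m σ g) (hgo : OrbitContains m σ X Y Z (Ioi a) g) : EqOn g f (Ici 0) := by
  have hα := ssAlpha_pos hm hσ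
  obtain ⟨η, himg, hη⟩ := hgo
  -- Injectivity of the powers: Z fixes the radius, and then X fixes the amplitude.
  have hsol : ∀ ξ, 0 < ξ → 0 < g ξ → r (η ξ) = ξ ∧ g ξ = φ (η ξ) := by
    intro ξ hξ hgξ
    have hmem : η ξ ∈ Ioi a := himg ▸ mem_image_of_mem η ⟨hξ, hgξ⟩
    obtain ⟨-, hX, -, hZ⟩ := hη ξ hξ hgξ
    rw [H.Z_eq _ hmem] at hZ
    rw [H.X_eq _ hmem] at hX
    have hr : r (η ξ) = ξ := by
      refine (Real.rpow_left_inj (H.r_pos _ hmem).le hξ.le (by linarith : σ - 2 ≠ 0)).mp ?_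
      exact mul_left_cancel₀ (by positivity) hZ
    rw [hr] at hX
    refine ⟨hr, ((Real.rpow_left_inj (H.φ_pos _ hmem).le hgξ.le
      (by linarith : m - 1 ≠ 0)).mp ?_).symm⟩
    exact mul_left_cancel₀ (by positivity) hX
  have hpos : ∀ ξ ∈ Ioi (0 : ℝ), g ξ = f ξ := by
    intro ξ hξ
    rcases lt_or_ge ξ ξ₀ with h | h
    -- As η maps onto the whole of (a, ∞), the time τ(ξ) is attained, and comparing radii shows that
    -- it is attained at ξ itself.
    · have h1 := hτ.mem ξ ⟨hξ, h⟩
      rw [← himg] at h1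
      obtain ⟨ξ', ⟨hξ', hgξ'⟩, he⟩ := h1
      obtain ⟨h2, h3⟩ := hsol ξ' hξ' hgξ'
      rw [he, hτ.right_inv ξ ⟨hξ, h⟩] at h2
      subst h2
      rw [h3, he, (hf ξ ⟨hξ, h⟩).1]
    · rw [C.eq_zero ξ h]
      by_contra hne
      have hgξ : 0 < g ξ := lt_of_le_of_ne (hg.nonneg ξ (le_of_lt hξ)) (Ne.symm hne)
      have hmem : η ξ ∈ Ioi a := himg ▸ mem_image_of_mem η ⟨hξ, hgξ⟩
      have := H.r_lt _ hmem
      rw [(hsol ξ hξ hgξ).1] at this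
      linarith
  intro ξ hξ
  rcases eq_or_lt_of_le (show (0 : ℝ) ≤ ξ from hξ) with h | h
  · subst h
    refine tendsto_nhds_unique (tendsto_nhdsGT_of_continuousOn hg.continuousOn) ?_
    refine (tendsto_nhdsGT_of_continuousOn C.continuousOn).congr' ?_
    filter_upwards [self_mem_nhdsWithin] with t ht using (hpos t ht).symm
  · exact hpos ξ h

end Contained

end SelfSimilar

/-! ### Conclusion. -/

theorem proposition3p1 (m p σ : ℝ) (hm1 : 1 < m) (hm2 : m < 2) (hmp : m + p = 2) (hσ : 2 < σ)
    (l : ℝ) (hl1 : -(SelfSimilar.ssBeta σ / SelfSimilar.ssAlpha m σ) < l)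
    (hl2 : l < -(SelfSimilar.ssBeta σ / (2 * SelfSimilar.ssAlpha m σ)))
    (X Y Z : ℝ → ℝ) (I : Set ℝ) (horbit : SelfSimilar.IsOrbit m σ X Y Z I)
    (henters : SelfSimilar.Enters X Y Z I (SelfSimilar.critPoint m σ l)) :
    (∃ f : ℝ → ℝ, SelfSimilar.IsProfile m σ f ∧ SelfSimilar.OrbitContains m σ X Y Z I f) ∧
    ∀ f : ℝ → ℝ, SelfSimilar.IsProfile m σ f → SelfSimilar.OrbitContains m σ X Y Z I f →
      AntitoneOn f (Set.Ici 0) ∧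
      0 < f 0 ∧
      (∃ s : ℝ, s < 0 ∧ HasDerivWithinAt f s (Set.Ici 0) 0) ∧
      ∀ T : ℝ, 0 < T →
        SelfSimilar.IsSupersolution m p σ T (SelfSimilar.selfSimilar m σ T f) := by
  open SelfSimilar in
  have hα := ssAlpha_pos hm1 hσ
  have hβ := ssBeta_pos hσ
  have hl2' : 2 * l < -(ssBeta σ / ssAlpha m σ) := by
    have : ssBeta σ / (2 * ssAlpha m σ) = ssBeta σ / ssAlpha m σ / 2 := by field_simp
    rw [this] at hl2
    linarith
  obtain ⟨a, ξ₀, r, φ, rfl, -, H⟩ := horbit.exists_radialOrbit hm1 hσ hl1 hl2' henters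
  obtain ⟨τ, hτ⟩ := H.exists_radialInverse (H.tendsto_r_zero hm1 hα hβ horbit)
  obtain ⟨f, y, C, hf⟩ := H.exists_compactProfile hm1 hm2 hα hβ hτ
  refine ⟨⟨f, C.isProfile hm1, C.orbitContains hm1 hσ H hτ hf⟩, fun g hg hgo => ?_⟩
  -- Any contained profile equals the constructed one on [0, ∞), so its properties and the limit of
  -- its derivative at 0 transfer.
  have heq := C.eqOn_of_orbitContains hm1 hσ H hτ hf hg hgo
  have hderiv : EqOn (deriv g) (deriv f) (Set.Ioi 0) := fun ξ hξ => by
    refine EventuallyEq.deriv_eq ?_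
    filter_upwards [Ioi_mem_nhds hξ] with t ht using heq (Ioi_subset_Ici_self ht)
  have hgc : ContinuousOn (deriv g) (Set.Ioi 0) := (C.continuousOn_deriv hm2).congr hderiv
  obtain ⟨s, hs, hfs⟩ := C.exists_tendsto_deriv hm1 hσ hα
  have hgs : Tendsto (deriv g) (𝓝[>] 0) (𝓝 s) :=
    hfs.congr' (mem_of_superset self_mem_nhdsWithin fun ξ hξ => (hderiv hξ).symm)
  refine ⟨(C.antitoneOn hm1 hm2 hα).congr heq.symm, ?_, ⟨s, hs, ?_⟩,
    fun T _ => hg.isSupersolution hm1 hm2 hmp hσ hgc hgs hs.le T⟩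
  · rw [heq Set.self_mem_Ici]
    exact C.pos 0 ⟨le_rfl, C.ξ₀_pos⟩
  · exact hasDerivWithinAt_Ici_of_tendsto_deriv (s := Set.Ioi 0)
      (fun ξ hξ => (hg.differentiableAt ξ hξ).differentiableWithinAt)
      ((hg.continuousOn 0 Set.self_mem_Ici).mono Set.Ioi_subset_Ici_self) self_mem_nhdsWithin hgs
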